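/- Let $\mathcal X$, $\mathcal W$, $\mathcal T$ be smooth Riemannian manifolds (Hausdorff, second countable, without boundary) of dimensions $k$, $m$, $l$, with Riemannian volume measures $\mu_{\mathcal X}$, $\mu_{\mathcal W}$, $\mu_{\mathcal T}$. Let $P$ be a probability measure on $\mathcal X$ with density $f\ge 0$ with respect to $\mu_{\mathcal X}$, and let $W:\mathcal X\to\mathcal W$ and $T:\mathcal X\to\mathcal T$ be onto and smooth, such that the differential $d(T,W)(x):T_x\mathcal X\to T_{T(x)}\mathcal T\oplus T_{W(x)}\mathcal W$ is surjective at every $x$ with $f(x)>0$. For a smooth map $F$ write $J_F(x)=|\det(dF(x)\circ dF(x)')|^{-1/2}$, where $dF(x)'$ is the adjoint of $dF(x)$; let $\nu_{W,w}$ be the volume measure of the $(k-m)$-dimensional submanifold $W^{-1}\{w\}$ and $\nu_{T,W,t,w}$ the volume measure of the $(k-l-m)$-dimensional submanifold $T^{-1}\{t\}\cap W^{-1}\{w\}$ (only their parts in $\{f>0\}$ matter below). Put $$f_W(w)=\int_{W^{-1}\{w\}} f(x)J_W(x)\,\nu_{W,w}(dx),$$ and let $P(\cdot\mid W(x)=w)$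 be the measure on $W^{-1}\{w\}$ with density $f(x)J_W(x)/f_W(w)$ with respect to $\nu_{W,w}$. Then: (i) $f_W$ is a density of $W$ under $P$ with respect to $\mu_{\mathcal W}$, and $w\mapsto P(\cdot\mid W(x)=w)$ is a version of the conditional distribution of $x$ given $W$: for measurable $A\subseteq\mathcal X$ and $B\subseteq\mathcal W$, the map $w\mapsto P(A\mid W(x)=w)$ is measurable and $P(A\cap W^{-1}B)=\int_B P(A\mid W(x)=w)\,P_W(dw)$, where $P_W$ is the distribution of $W$ under $P$. (ii) For every $w$ with $0<f_W(w)<\infty$, $P(\cdot\mid W(x)=w)$ is a probability measure, and under it $T$ has density with respect to $\mu_{\mathcal T}$ $$f_{T,W}(t\mid w)=\int_{T^{-1}\{t\}\cap W^{-1}\{w\}}\frac{f(x)}{f_W(w)}\,J_{(T,W)}(x)\,\nu_{T,W,t,w}(dx).$$ (iii) Let $x_0\in\mathcal X$, $t_0=T(x_0)$, $w_0=W(x_0)$ with $0<f_W(w_0)<\infty$. The volume-corrected conditional density $\tilde f_{T,W}(t\mid w_0)$ is obtained from $f_{T,W}(t\mid w_0)$ by dividing the integrand by the volume distortion factor $J_{(T,W)}(x)$.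 The conditional P-value based on it is $$P_T\big(\tilde f_{T,W}(t\mid w_0)\le \tilde f_{T,W}(t_0\mid w_0)\,\big|\,W(x)=w_0\big)=P_T\big(f^*_{T,W}(t\mid w_0)\le f^*_{T,W}(t_0\mid w_0)\,\big|\,W(x)=w_0\big),$$ where $f^*_{T,W}(t\mid w_0)=\int_{T^{-1}\{t\}\cap W^{-1}\{w_0\}} f(x)\,\nu_{T,W,t,w_0}(dx)$ is a measurable function of $t$ and $P_T(\cdot\mid W(x)=w_0)$ is the distribution of $T$ under $P(\cdot\mid W(x)=w_0)$. -/

import Mathlib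

open scoped Manifold ContDiff ENNReal NNReal
open MeasureTheory Bundle

noncomputable section

/-! ### Volume measures of Riemannian manifolds and of their submanifolds -/

section Volume

variable {n : ℕ} {M : Type*} [TopologicalSpace M] [ChartedSpace (EuclideanSpace ℝ (Fin n)) M]

/-- `ψ`, restricted to the open set `U ⊆ ℝᵈ`, is a local parametrization of the `d`-dimensional
embedded submanifold `S` of `M`: a smooth injective immersion with values in `S` which is a
homeomorphism onto a relatively open subset of `S`. For `S = M` and `d = dim M` these are the
inverses of the smooth charts of `M`. -/
structure IsLocalParam (S : Set M) {d : ℕ} (U : Set (EuclideanSpace ℝ (Fin d)))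
    (ψ : EuclideanSpace ℝ (Fin d) → M) : Prop where
  isOpen : IsOpen U
  smooth : ContMDiffOn (𝓡 d) (𝓡 n) ∞ ψ U
  injOn : Set.InjOn ψ U
  immersion : ∀ u ∈ U, Function.Injective (mfderiv (𝓡 d) (𝓡 n) ψ u)
  mapsTo : Set.MapsTo ψ U S
  isOpen_image : ∀ V ⊆ U, IsOpen V → ∃ O : Set M, IsOpen O ∧ ψ '' V = O ∩ S

variable [RiemannianBundle (fun x : M => TangentSpace (𝓡 n) x)]

/-- The Riemannian volume density `√ det (⟨∂ᵢψ, ∂ⱼψ⟩)` of a parametrization `ψ` at `u`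
(it is `1` if `d = 0`). -/
def volDensity {d : ℕ} (ψ : EuclideanSpace ℝ (Fin d) → M) (u : EuclideanSpace ℝ (Fin d)) : ℝ :=
  Real.sqrt (Matrix.det (Matrix.of fun i j : Fin d =>
    inner ℝ (mfderiv (𝓡 d) (𝓡 n) ψ u (EuclideanSpace.single i (1 : ℝ)))
      (mfderiv (𝓡 d) (𝓡 n) ψ u (EuclideanSpace.single j (1 : ℝ)))))

/-- The `d`-dimensional volume measure of a `d`-dimensional submanifold `S` of the Riemannian
manifold `M` (for the metric induced on `S`), as a measure on `M` carried by `S`: the least measure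
that dominates `√ det (⟨∂ᵢψ, ∂ⱼψ⟩) du` on the image of every local parametrization `ψ` of `S`.
By the change of variables formula these local measures agree on overlaps, so that the volume
measure coincides with the local one on each parametrized piece. In dimension `0` it is the counting
measure of `S`. -/
def volumeOn [MeasurableSpace M] (d : ℕ) (S : Set M) : Measure M :=
  ⨆ p : {p : Set (EuclideanSpace ℝ (Fin d)) × (EuclideanSpace ℝ (Fin d) → M) //
      IsLocalParam (n := n) S p.1 p.2},
    Measure.map p.1.2 ((volume.restrict p.1.1).withDensity
      fun u => ENNReal.ofReal (volDensity (n := n) p.1.2 u))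

end Volume

/-- The Riemannian volume measure of an `n`-dimensional Riemannian manifold `M`. -/
def riemVolume (n : ℕ) (M : Type*) [TopologicalSpace M] [ChartedSpace (EuclideanSpace ℝ (Fin n)) M]
    [RiemannianBundle (fun x : M => TangentSpace (𝓡 n) x)] [MeasurableSpace M] : Measure M :=
  volumeOn (n := n) n (Set.univ : Set M)

/-! ### The Jacobian factors -/

instance instFiniteDimensionalTangent {n : ℕ} {M : Type*} [TopologicalSpace M]
    [ChartedSpace (EuclideanSpace ℝ (Fin n)) M]
    [RiemannianBundle (fun x : M => TangentSpace (𝓡 n) x)] (x : M) :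
    FiniteDimensional ℝ (TangentSpace (𝓡 n) x) :=
  inferInstanceAs (FiniteDimensional ℝ (EuclideanSpace ℝ (Fin n)))

/-- `|det (A ∘ A')|^{-1/2}`, where `A'` is the adjoint of the linear map `A`. -/
def jacFactor {E F : Type*} [NormedAddCommGroup E] [InnerProductSpace ℝ E] [FiniteDimensional ℝ E]
    [NormedAddCommGroup F] [InnerProductSpace ℝ F] [FiniteDimensional ℝ F] (A : E →ₗ[ℝ] F) : ℝ≥0∞ :=
  ENNReal.ofReal (|LinearMap.det (A ∘ₗ LinearMap.adjoint A)| ^ (-(1 / 2) : ℝ))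

section Jacobian

variable {k l m : ℕ}
  {𝒳 : Type*} [TopologicalSpace 𝒳] [ChartedSpace (EuclideanSpace ℝ (Fin k)) 𝒳]
  [RiemannianBundle (fun x : 𝒳 => TangentSpace (𝓡 k) x)]
  {𝒲 : Type*} [TopologicalSpace 𝒲] [ChartedSpace (EuclideanSpace ℝ (Fin m)) 𝒲]
  [RiemannianBundle (fun x : 𝒲 => TangentSpace (𝓡 m) x)]
  {𝒯 : Type*} [TopologicalSpace 𝒯] [ChartedSpace (EuclideanSpace ℝ (Fin l)) 𝒯]
  [RiemannianBundle (fun x : 𝒯 => TangentSpace (𝓡 l) x)]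

/-- The factor `J_W(x) = |det (dW(x) ∘ dW'(x))|^{-1/2}`. -/
def jac (W : 𝒳 → 𝒲) (x : 𝒳) : ℝ≥0∞ :=
  jacFactor (mfderiv (𝓡 k) (𝓡 m) W x).toLinearMap

/-- The differential of `(T, W) : 𝒳 → 𝒯 × 𝒲` at `x`, with values in the orthogonal direct sum of
the tangent spaces of `𝒯` and `𝒲`, which is the tangent space of the Riemannian product. -/
def pairDeriv (T : 𝒳 → 𝒯) (W : 𝒳 → 𝒲) (x : 𝒳) :
    TangentSpace (𝓡 k) x →ₗ[ℝ] WithLp 2 (TangentSpace (𝓡 l) (T x) × TangentSpace (𝓡 m) (W x)) :=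
  (WithLp.linearEquiv 2 ℝ
      (TangentSpace (𝓡 l) (T x) × TangentSpace (𝓡 m) (W x))).symm.toLinearMap ∘ₗ
    (mfderiv (𝓡 k) (𝓡 l) T x).toLinearMap.prod (mfderiv (𝓡 k) (𝓡 m) W x).toLinearMap

/-- The factor `J_{(T,W)}(x) = |det (d(T,W)(x) ∘ d(T,W)'(x))|^{-1/2}`. -/
def jacPair (T : 𝒳 → 𝒯) (W : 𝒳 → 𝒲) (x : 𝒳) : ℝ≥0∞ :=
  jacFactor (pairDeriv (k := k) (l := l) (m := m) T W x)

end Jacobian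

/-! ### Densities, conditional distributions and P-values -/

section Densities

variable {k l m : ℕ}
  {𝒳 : Type*} [TopologicalSpace 𝒳] [ChartedSpace (EuclideanSpace ℝ (Fin k)) 𝒳]
  [RiemannianBundle (fun x : 𝒳 => TangentSpace (𝓡 k) x)] [MeasurableSpace 𝒳]
  {𝒲 : Type*} [TopologicalSpace 𝒲] [ChartedSpace (EuclideanSpace ℝ (Fin m)) 𝒲]
  [RiemannianBundle (fun x : 𝒲 => TangentSpace (𝓡 m) x)]
  {𝒯 : Type*} [TopologicalSpace 𝒯] [ChartedSpace (EuclideanSpace ℝ (Fin l)) 𝒯]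
  [RiemannianBundle (fun x : 𝒯 => TangentSpace (𝓡 l) x)]

/-- The volume measure `ν_{W,w}` of the fibre `W⁻¹{w}`, a submanifold of dimension `k - m`. -/
def fibreVolume (W : 𝒳 → 𝒲) (w : 𝒲) : Measure 𝒳 :=
  volumeOn (n := k) (k - m) (W ⁻¹' {w})

/-- The volume measure `ν_{T,W,t,w}` of `T⁻¹{t} ∩ W⁻¹{w}`, a submanifold of dimension
`k - (l + m)`. -/
def jointFibreVolume (T : 𝒳 → 𝒯) (W : 𝒳 → 𝒲) (t : 𝒯) (w : 𝒲) : Measure 𝒳 :=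
  volumeOn (n := k) (k - (l + m)) (T ⁻¹' {t} ∩ W ⁻¹' {w})

/-- `f_W(w) = ∫_{W⁻¹{w}} f(x) J_W(x) ν_{W,w}(dx)`. -/
def marginalDensity (f : 𝒳 → ℝ≥0) (W : 𝒳 → 𝒲) (w : 𝒲) : ℝ≥0∞ :=
  ∫⁻ x, f x * jac (k := k) (m := m) W x ∂(fibreVolume (k := k) (m := m) W w)

/-- The conditional distribution `P(· | W(x) = w)` of `x`: the measure with density
`f(x) J_W(x) / f_W(w)` with respect to the volume measure of `W⁻¹{w}`. -/
def condLaw (f : 𝒳 → ℝ≥0) (W : 𝒳 → 𝒲) (w : 𝒲) : Measure 𝒳 :=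
  (fibreVolume (k := k) (m := m) W w).withDensity
    fun x => f x * jac (k := k) (m := m) W x / marginalDensity (k := k) (m := m) f W w

/-- `f_{T,W}(t | w) = ∫_{T⁻¹{t} ∩ W⁻¹{w}} (f(x) / f_W(w)) J_{(T,W)}(x) ν_{T,W,t,w}(dx)`. -/
def condDensity (f : 𝒳 → ℝ≥0) (T : 𝒳 → 𝒯) (W : 𝒳 → 𝒲) (t : 𝒯) (w : 𝒲) : ℝ≥0∞ :=
  ∫⁻ x, f x / marginalDensity (k := k) (m := m) f W w * jacPair (k := k) (l := l) (m := m) T W x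
    ∂(jointFibreVolume (k := k) (l := l) (m := m) T W t w)

/-- The conditional density of `T` given `W = w` corrected for volume distortion: the integrand of
`condDensity` is divided by the distortion factor `J_{(T,W)}(x)`. -/
def correctedCondDensity (f : 𝒳 → ℝ≥0) (T : 𝒳 → 𝒯) (W : 𝒳 → 𝒲) (t : 𝒯) (w : 𝒲) : ℝ≥0∞ :=
  ∫⁻ x, f x / marginalDensity (k := k) (m := m) f W w * jacPair (k := k) (l := l) (m := m) T W x
      / jacPair (k := k) (l := l) (m := m) T W x
    ∂(jointFibreVolume (k := k) (l := l) (m := m) T W t w)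

/-- `f*_{T,W}(t | w) = ∫_{T⁻¹{t} ∩ W⁻¹{w}} f(x) ν_{T,W,t,w}(dx)`. -/
def fStar (f : 𝒳 → ℝ≥0) (T : 𝒳 → 𝒯) (W : 𝒳 → 𝒲) (t : 𝒯) (w : 𝒲) : ℝ≥0∞ :=
  ∫⁻ x, f x ∂(jointFibreVolume (k := k) (l := l) (m := m) T W t w)

/-- The conditional P-value `P_T(g(t) ≤ g(t₀) | W(x) = w₀)` based on a function `g` of `t`, at the
observation `x₀`, where `t₀ = T(x₀)` and `w₀ = W(x₀)`. -/
def condPValue [MeasurableSpace 𝒯] (f : 𝒳 → ℝ≥0) (T : 𝒳 → 𝒯) (W : 𝒳 → 𝒲) (g : 𝒯 → ℝ≥0∞)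
    (x₀ : 𝒳) : ℝ≥0∞ :=
  (condLaw (k := k) (m := m) f W (W x₀)).map T {t | g t ≤ g (T x₀)}

end Densities

end

/-! Everything follows from one coarea formula, for the restriction of `T` to a fibre of `W`. If `g
≥ 0` is measurable and vanishes where `d(T,W)` is not onto, then for every `w` the integral of `g
J_W` over `W⁻¹{w}` is the integral over `t` of the integrals of `g J_{(T,W)}` over `T⁻¹{t} ∩ W⁻¹{w}`
(`lintegral_fibre_mul_jac`).

Near a regular point the inverse function theorem gives coordinates `(a, b, z)` in which `T` and `W`
are `a` and `b` (`exists_isAdaptedChart`). The fibres are then coordinate slices, their volume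
measures have Gram densities (`IsLocalParam.volumeOn_restrict`), and both sides become integrals
over `(a, z)`, compared by Tonelli. The integrands agree by linear algebra: if a basis `u` consists
of vectors that a surjective `A` maps to a basis `v`, followed by vectors of `ker A`, then `J_A =
vol u / (vol v · vol (u in ker A))` (`jacFactor_eq_gramVolume`). For `dW` and `d(T,W)` in the same
basis, the total volume and the volume on `𝒲` are common to both, which leaves the relation
`jac_mul_fibreDensity`. By second countability, countably many such charts cover the regular points,
and `g` is cut into pieces supported in single charts.

With `W` in the place of `T` and a constant map to a point in the place of `W`, this becomes the
usual coarea formula (`lintegral_riemVolume_eq_lintegral_fibre`). Applied to `f` times the indicator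
of `A ∩ W⁻¹B`, it yields the density of `W` and the disintegration of `P`. The fibrewise formula
applied to `f / f_W(w)` times the indicator of `T⁻¹B` yields the conditional density of `T`.
Finally, `J_{(T,W)}` is finite and nonzero where `f > 0`, so dividing by it cancels it: the
corrected density is `f* / f_W(w₀)`, and a positive finite constant does not change the event that
defines the P-value. -/

/-! ### Gram determinants and the Jacobian factor of a surjective linear map -/

section LinearAlgebra

set_option linter.unusedSectionVars false

variable {α β ι κ : Type*} [Fintype α] [DecidableEq α] [Fintype β] [DecidableEq β]
  [Fintype ι] [DecidableEq ι] [Fintype κ] [DecidableEq κ]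
  {E F : Type*} [NormedAddCommGroup E] [InnerProductSpace ℝ E]
  [NormedAddCommGroup F] [InnerProductSpace ℝ F]

/-- Jacobi's identity for complementary minors. The first block column of `H` is sent by `G` to that
of the identity; completing it by the second block column of the identity gives a product of block
triangular matrices, and determinants are taken. -/
theorem Matrix.det_toBlocks₁₁_mul_det_of_mul_eq_one {R : Type*} [CommRing R]
    {G H : Matrix (α ⊕ β) (α ⊕ β) R} (h : G * H = 1) :
    H.toBlocks₁₁.det * G.det = G.toBlocks₂₂.det := by
  rw [← Matrix.fromBlocks_toBlocks G, ← Matrix.fromBlocks_toBlocks H,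
    Matrix.fromBlocks_multiply, ← Matrix.fromBlocks_one, Matrix.fromBlocks_inj] at h
  have key : G * Matrix.fromBlocks H.toBlocks₁₁ 0 H.toBlocks₂₁ 1
      = Matrix.fromBlocks 1 G.toBlocks₁₂ 0 G.toBlocks₂₂ := by
    nth_rewrite 1 [← Matrix.fromBlocks_toBlocks G]
    rw [Matrix.fromBlocks_multiply, h.1, h.2.2.1]
    simp
  have := congrArg Matrix.det key
  rw [Matrix.det_mul, Matrix.det_fromBlocks_zero₁₂, Matrix.det_fromBlocks_zero₂₁] at this
  simpa [mul_comm] using this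

theorem OrthonormalBasis.gram_eq_transpose_mul (e : OrthonormalBasis κ ℝ E) (w : ι → E) :
    Matrix.gram ℝ w = (e.toBasis.toMatrix w).transpose * e.toBasis.toMatrix w := by
  ext i j
  rw [Matrix.gram_apply, Matrix.mul_apply, ← e.sum_inner_mul_inner (w i) (w j)]
  refine Finset.sum_congr rfl fun a _ => ?_
  simp [Module.Basis.toMatrix_apply, e.repr_apply_apply, real_inner_comm]

theorem exists_orthonormalBasis_of_basis [FiniteDimensional ℝ E] (u : Module.Basis ι ℝ E) :
    Nonempty (OrthonormalBasis ι ℝ E) :=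
  ⟨(stdOrthonormalBasis ℝ E).reindex (Fintype.equivOfCardEq (by
    rw [Fintype.card_fin, Module.finrank_eq_card_basis u]))⟩

theorem Module.Basis.det_gram_pos [FiniteDimensional ℝ E] (u : Module.Basis ι ℝ E) :
    0 < (Matrix.gram ℝ u).det := by
  obtain ⟨e⟩ := exists_orthonormalBasis_of_basis u
  rw [e.gram_eq_transpose_mul, Matrix.det_mul, Matrix.det_transpose]
  have : (e.toBasis.toMatrix u).det ≠ 0 := by
    have := congrArg Matrix.det (e.toBasis.toMatrix_mul_toMatrix_flip u)
    rw [Matrix.det_mul, Matrix.det_one] at this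
    exact left_ne_zero_of_mul_eq_one this
  exact mul_self_pos.2 this

theorem det_gram_pos_of_linearIndependent {u : ι → E} (hu : LinearIndependent ℝ u) :
    0 < (Matrix.gram ℝ u).det := by
  let b := Module.Basis.span hu
  have := b.finiteDimensional_of_finite
  have hb := b.det_gram_pos
  have : Matrix.gram ℝ u = Matrix.gram ℝ b := by
    ext i j
    simp only [Matrix.gram_apply, b, Submodule.coe_inner, Module.Basis.span_apply]
  rwa [this]

/-- Composing with `N` changes the Gram matrix by congruence with the matrix of `N`. No injectivity
of `φ` is involved. -/
theorem det_gram_of_comp {φ : F →ₗ[ℝ] E} (b : Module.Basis ι ℝ F) (N : F →ₗ[ℝ] F) :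
    (Matrix.gram ℝ fun i => φ (N (b i))).det
      = LinearMap.det N ^ 2 * (Matrix.gram ℝ fun i => φ (b i)).det := by
  have key : (Matrix.gram ℝ fun i => φ (N (b i)))
      = (LinearMap.toMatrix b b N).transpose * (Matrix.gram ℝ fun i => φ (b i))
        * LinearMap.toMatrix b b N := by
    ext i j
    have h : ∀ j, φ (N (b j)) = ∑ a, LinearMap.toMatrix b b N a j • φ (b a) := by
      intro j
      conv_lhs => rw [← b.sum_repr (N (b j)), map_sum]
      simp [LinearMap.toMatrix_apply]
    rw [Matrix.gram_apply, h i, h j, Matrix.mul_assoc, Matrix.mul_apply, sum_inner]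
    refine Finset.sum_congr rfl fun a _ => ?_
    rw [Matrix.mul_apply, inner_sum, Matrix.transpose_apply, Finset.mul_sum]
    refine Finset.sum_congr rfl fun c _ => ?_
    rw [real_inner_smul_left, real_inner_smul_right, Matrix.gram_apply]
    ring
  rw [key, Matrix.det_mul, Matrix.det_mul, Matrix.det_transpose, LinearMap.det_toMatrix]
  ring

variable [FiniteDimensional ℝ E] [FiniteDimensional ℝ F]

/-- The coarea identity of linear algebra, in terms of Gram determinants. -/
theorem det_comp_adjoint_mul_det_gram (A : E →ₗ[ℝ] F) (u : Module.Basis (α ⊕ β) ℝ E)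
    (v : Module.Basis α ℝ F) (hl : ∀ i, A (u (Sum.inl i)) = v i)
    (hr : ∀ j, A (u (Sum.inr j)) = 0) :
    LinearMap.det (A ∘ₗ LinearMap.adjoint A) * (Matrix.gram ℝ u).det
      = (Matrix.gram ℝ v).det * (Matrix.gram ℝ fun j => u (Sum.inr j)).det := by
  obtain ⟨e⟩ := exists_orthonormalBasis_of_basis u
  obtain ⟨h⟩ := exists_orthonormalBasis_of_basis v
  set U := e.toBasis.toMatrix u with hU
  set K := u.toMatrix e.toBasis with hK
  set M := LinearMap.toMatrix e.toBasis h.toBasis A with hM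
  set V := h.toBasis.toMatrix v with hV
  have hUK : U * K = 1 := e.toBasis.toMatrix_mul_toMatrix_flip u
  have hKU : K * U = 1 := u.toMatrix_mul_toMatrix_flip e.toBasis
  have hMU : M * U = Matrix.fromCols V (0 : Matrix α β ℝ) := by
    rw [hM, hU, linearMap_toMatrix_mul_basis_toMatrix]
    ext i (j | j)
    · simp [LinearMap.toMatrix_apply, hl, hV, Module.Basis.toMatrix_apply]
    · simp [LinearMap.toMatrix_apply, hr]
  -- In orthonormal bases `A` is `[V 0] K`, so that `A A'` is `V (K Kᵀ)₁₁ Vᵀ`. Since `K Kᵀ` is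
  -- inverse to the Gram matrix of `u`, the complementary minor identity turns this corner into the
  -- Gram determinant of the kernel vectors.
  have hM' : M = Matrix.fromCols V (0 : Matrix α β ℝ) * K := by
    rw [← hMU, Matrix.mul_assoc, hUK, Matrix.mul_one]
  have hG : Matrix.gram ℝ u = U.transpose * U := e.gram_eq_transpose_mul u
  have hGv : Matrix.gram ℝ v = V.transpose * V := h.gram_eq_transpose_mul v
  have hGH : Matrix.gram ℝ u * (K * K.transpose) = 1 := by
    rw [hG, Matrix.mul_assoc, ← Matrix.mul_assoc U, hUK, Matrix.one_mul,
      ← Matrix.transpose_mul, hKU, Matrix.transpose_one]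
  have hdet : LinearMap.det (A ∘ₗ LinearMap.adjoint A) = (M * M.transpose).det := by
    rw [← LinearMap.det_toMatrix h.toBasis, LinearMap.toMatrix_comp h.toBasis e.toBasis,
      LinearMap.toMatrix_adjoint, Matrix.conjTranspose_eq_transpose_of_trivial]
  have hMM : M * M.transpose = V * (K * K.transpose).toBlocks₁₁ * V.transpose := by
    rw [hM', Matrix.transpose_mul, Matrix.mul_assoc, ← Matrix.mul_assoc K,
      ← Matrix.fromBlocks_toBlocks (K * K.transpose), Matrix.transpose_fromCols,
      ← Matrix.mul_assoc, Matrix.fromCols_mul_fromBlocks, Matrix.fromCols_mul_fromRows]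
    simp
  have hblk : (Matrix.gram ℝ u).toBlocks₂₂ = Matrix.gram ℝ fun j => u (Sum.inr j) := by
    ext i j; rfl
  rw [hdet, hMM, Matrix.det_mul, Matrix.det_mul, hGv, Matrix.det_mul, ← hblk,
    ← Matrix.det_toBlocks₁₁_mul_det_of_mul_eq_one hGH]
  simp only [Matrix.det_transpose]
  ring

/-- The volume spanned by a family of vectors. -/
noncomputable def gramVolume (u : ι → E) : ℝ := Real.sqrt (Matrix.gram ℝ u).det

omit [FiniteDimensional ℝ E] in
theorem gramVolume_pos {u : ι → E} (hu : LinearIndependent ℝ u) : 0 < gramVolume u :=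
  Real.sqrt_pos.2 (det_gram_pos_of_linearIndependent hu)

theorem det_comp_adjoint_pos (A : E →ₗ[ℝ] F) (u : Module.Basis (α ⊕ β) ℝ E)
    (v : Module.Basis α ℝ F) (hl : ∀ i, A (u (Sum.inl i)) = v i)
    (hr : ∀ j, A (u (Sum.inr j)) = 0) :
    0 < LinearMap.det (A ∘ₗ LinearMap.adjoint A) := by
  have h := det_comp_adjoint_mul_det_gram A u v hl hr
  have h1 := u.det_gram_pos
  have h2 := v.det_gram_pos
  have h3 : 0 < (Matrix.gram ℝ fun j => u (Sum.inr j)).det :=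
    det_gram_pos_of_linearIndependent (u.linearIndependent.comp _ Sum.inr_injective)
  nlinarith [mul_pos h2 h3]

/-- The coarea identity of linear algebra. -/
theorem jacFactor_eq_gramVolume (A : E →ₗ[ℝ] F) (u : Module.Basis (α ⊕ β) ℝ E)
    (v : Module.Basis α ℝ F) (hl : ∀ i, A (u (Sum.inl i)) = v i)
    (hr : ∀ j, A (u (Sum.inr j)) = 0) :
    jacFactor A = ENNReal.ofReal
      (gramVolume u / (gramVolume v * gramVolume fun j => u (Sum.inr j))) := by
  have h := det_comp_adjoint_mul_det_gram A u v hl hr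
  have h0 := det_comp_adjoint_pos A u v hl hr
  have h1 := u.det_gram_pos
  have h2 := v.det_gram_pos
  have h3 : 0 < (Matrix.gram ℝ fun j => u (Sum.inr j)).det :=
    det_gram_pos_of_linearIndependent (u.linearIndependent.comp _ Sum.inr_injective)
  rw [jacFactor, abs_of_pos h0, Real.rpow_neg h0.le, ← Real.sqrt_eq_rpow]
  congr 1
  simp only [gramVolume]
  rw [← Real.sqrt_mul h2.le, ← h, Real.sqrt_mul h0.le, div_mul_cancel_right₀]
  exact (Real.sqrt_pos.2 h1).ne'

omit [FiniteDimensional ℝ E] in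
theorem gramVolume_comp_equiv (u : ι → E) (σ : κ ≃ ι) :
    (gramVolume fun i => u (σ i)) = gramVolume u := by
  unfold gramVolume
  have : (Matrix.gram ℝ fun i => u (σ i)) = (Matrix.gram ℝ u).submatrix σ σ := rfl
  rw [this, Matrix.det_submatrix_equiv_self]

-- In an orthogonal direct sum the mixed inner products vanish and the Gram matrix is block
-- diagonal. This separates the volumes on `𝒯` and `𝒲` in `J_{(T,W)}`.
omit [FiniteDimensional ℝ E] [FiniteDimensional ℝ F] in
theorem gramVolume_prod (v : α → E) (w : β → F) :
    (gramVolume (Sum.elim (fun i => WithLp.toLp 2 (v i, (0 : F)))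
      fun j => WithLp.toLp 2 ((0 : E), w j))) = gramVolume v * gramVolume w := by
  have : Matrix.gram ℝ (Sum.elim (fun i => WithLp.toLp 2 (v i, (0 : F)))
      fun j => WithLp.toLp 2 ((0 : E), w j))
      = Matrix.fromBlocks (Matrix.gram ℝ v) 0 0 (Matrix.gram ℝ w) := by
    ext (i | i) (j | j) <;> simp [Matrix.gram_apply]
  unfold gramVolume
  rw [this, Matrix.det_fromBlocks_zero₂₁, Real.sqrt_mul]
  exact (Matrix.posSemidef_gram ℝ v).det_nonneg

end LinearAlgebra

/-! ### Volumes spanned by tangent vectors -/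

section TangentVolume

variable {n d : ℕ} {M : Type*} [TopologicalSpace M] [ChartedSpace (EuclideanSpace ℝ (Fin n)) M]
  {E : Type*} [NormedAddCommGroup E] [NormedSpace ℝ E] {ι : Type*} [Fintype ι] [DecidableEq ι]

/-- The differential of a map from a vector space to a manifold, with the tangent spaces replaced
by the model space. -/
noncomputable def tangentMapCoord (ψ : E → M) (u : E) : E →L[ℝ] EuclideanSpace ℝ (Fin n) :=
  mfderiv 𝓘(ℝ, E) (𝓡 n) ψ u

variable [RiemannianBundle (fun x : M => TangentSpace (𝓡 n) x)]

/-- The volume spanned by a family of vectors of the tangent space at `x`. -/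
noncomputable def tangentVolume (x : M) (v : ι → EuclideanSpace ℝ (Fin n)) : ℝ :=
  gramVolume (E := TangentSpace (𝓡 n) x) v

theorem volDensity_eq_tangentVolume (ψ : EuclideanSpace ℝ (Fin d) → M)
    (u : EuclideanSpace ℝ (Fin d)) :
    volDensity (n := n) ψ u = tangentVolume (ψ u)
      fun i => tangentMapCoord (n := n) ψ u (EuclideanSpace.single i 1) := rfl

/-- The source of the Jacobian determinant when two parametrizations of a submanifold are compared.
-/
theorem tangentVolume_comp {E : Type*} [NormedAddCommGroup E] [InnerProductSpace ℝ E]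
    (x : M) (b : Module.Basis ι ℝ E)
    (φ : E →L[ℝ] EuclideanSpace ℝ (Fin n)) (N : E →L[ℝ] E) :
    tangentVolume x (fun i => φ (N (b i))) = |N.det| * tangentVolume x fun i => φ (b i) := by
  let φ' : E →ₗ[ℝ] TangentSpace (𝓡 n) x := φ.toLinearMap
  have key := det_gram_of_comp (φ := φ') b N.toLinearMap
  have h1 : tangentVolume x (fun i => φ (N (b i)))
    = Real.sqrt (Matrix.gram ℝ fun i => φ' (N.toLinearMap (b i))).det := rfl
  have h2 : tangentVolume x (fun i => φ (b i))
    = Real.sqrt (Matrix.gram ℝ fun i => φ' (b i)).det := rfl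
  rw [h1, h2, key, Real.sqrt_mul (sq_nonneg _), Real.sqrt_sq_eq_abs]

end TangentVolume

/-! ### Change of variables between local parametrizations -/

section LocalParam

set_option linter.unusedSectionVars false

open Set Filter Topology

variable {n d : ℕ} {M : Type*} [TopologicalSpace M] [ChartedSpace (EuclideanSpace ℝ (Fin n)) M]
  {S E : Set M} {U U₁ : Set (EuclideanSpace ℝ (Fin d))} {ψ ψ₁ : EuclideanSpace ℝ (Fin d) → M}

namespace IsLocalParam

theorem continuousOn (h : IsLocalParam (n := n) S U ψ) : ContinuousOn ψ U := h.smooth.continuousOn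

theorem mdifferentiableAt (h : IsLocalParam (n := n) S U ψ) {u : EuclideanSpace ℝ (Fin d)}
    (hu : u ∈ U) : MDifferentiableAt (𝓡 d) (𝓡 n) ψ u :=
  (h.smooth.contMDiffAt (h.isOpen.mem_nhds hu)).mdifferentiableAt (by simp)

/-- The image of `V` is the trace on `S` of an open set `O`, and `ψ₁` takes its values in `S`, so
only the preimage of `O` under the continuous `ψ₁` matters. -/
theorem isOpen_overlap (h : IsLocalParam (n := n) S U ψ) (h₁ : IsLocalParam (n := n) S U₁ ψ₁)
    {V : Set (EuclideanSpace ℝ (Fin d))} (hV : IsOpen V) (hVU : V ⊆ U) :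
    IsOpen (U₁ ∩ ψ₁ ⁻¹' (ψ '' V)) := by
  obtain ⟨O, hO, hOV⟩ := h.isOpen_image V hVU hV
  have : U₁ ∩ ψ₁ ⁻¹' (ψ '' V) = U₁ ∩ ψ₁ ⁻¹' O := by
    ext u
    simp only [hOV, mem_inter_iff, mem_preimage]
    exact ⟨fun hu => ⟨hu.1, hu.2.1⟩, fun hu => ⟨hu.1, hu.2, h₁.mapsTo hu.1⟩⟩
  rw [this]
  exact h₁.continuousOn.isOpen_inter_preimage h₁.isOpen hO

variable (U ψ ψ₁) in
/-- The change of coordinates from one parametrization to another. -/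
noncomputable def transition (u : EuclideanSpace ℝ (Fin d)) : EuclideanSpace ℝ (Fin d) :=
  Function.invFunOn ψ U (ψ₁ u)

theorem transition_mem {u : EuclideanSpace ℝ (Fin d)} (hu : ψ₁ u ∈ ψ '' U) :
    transition U ψ ψ₁ u ∈ U := Function.invFunOn_mem hu

theorem apply_transition {u : EuclideanSpace ℝ (Fin d)} (hu : ψ₁ u ∈ ψ '' U) :
    ψ (transition U ψ ψ₁ u) = ψ₁ u := Function.invFunOn_eq hu

/-- Relative openness of the images `ψ '' V` is continuity of the inverse of `ψ`. This has to
precede differentiability: it keeps the transition inside the domain of a local inverse. -/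
theorem tendsto_transition (h : IsLocalParam (n := n) S U ψ) (h₁ : IsLocalParam (n := n) S U₁ ψ₁)
    {u : EuclideanSpace ℝ (Fin d)} (hu : u ∈ U₁) (hu' : ψ₁ u ∈ ψ '' U) :
    Tendsto (transition U ψ ψ₁) (𝓝 u) (𝓝 (transition U ψ ψ₁ u)) := by
  rw [tendsto_nhds]
  intro V hV huV
  have hop := h.isOpen_overlap h₁ (hV.inter h.isOpen) inter_subset_right
  refine mem_of_superset (hop.mem_nhds ⟨hu, _, ⟨huV, transition_mem hu'⟩, apply_transition hu'⟩) ?_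
  rintro u' ⟨-, y, ⟨hyV, hyU⟩, hy⟩
  have h1 : ψ₁ u' ∈ ψ '' U := ⟨y, hyU, hy⟩
  have : transition U ψ ψ₁ u' = y :=
    h.injOn (transition_mem h1) hyU ((apply_transition h1).trans hy.symm)
  rw [mem_preimage, this]
  exact hyV

variable [IsManifold (𝓡 n) ∞ M]

/-- An immersion read in a chart `c` has a derivative with a linear left inverse `Λ`. Then `Λ ∘ c ∘
ψ` has the identity as derivative, hence a local inverse, and the transition is that local inverse
after `Λ ∘ c ∘ ψ₁`. -/
theorem differentiableAt_transition (h : IsLocalParam (n := n) S U ψ)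
    (h₁ : IsLocalParam (n := n) S U₁ ψ₁)
    {u : EuclideanSpace ℝ (Fin d)} (hu : u ∈ U₁) (hu' : ψ₁ u ∈ ψ '' U) :
    DifferentiableAt ℝ (transition U ψ ψ₁) u := by
  set y := transition U ψ ψ₁ u with hy
  have hyU : y ∈ U := transition_mem hu'
  have hyx : ψ y = ψ₁ u := apply_transition hu'
  set c := extChartAt (𝓡 n) (ψ y) with hc
  have hcs : ContMDiffAt (𝓡 n) (𝓡 n) ∞ c (ψ y) := contMDiffAt_extChartAt
  have hcs' : ContMDiffAt (𝓡 n) (𝓡 n) ∞ c (ψ₁ u) := hyx ▸ hcs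
  have hF : ContMDiffAt (𝓡 d) (𝓡 n) ∞ (c ∘ ψ) y :=
    hcs.comp y (h.smooth.contMDiffAt (h.isOpen.mem_nhds hyU))
  have hF₁ : ContMDiffAt (𝓡 d) (𝓡 n) ∞ (c ∘ ψ₁) u :=
    hcs'.comp u (h₁.smooth.contMDiffAt (h₁.isOpen.mem_nhds hu))
  rw [contMDiffAt_iff_contDiffAt] at hF hF₁
  have hinj : Function.Injective (fderiv ℝ (c ∘ ψ) y) := by
    have h1 : mfderiv (𝓡 d) (𝓡 n) (c ∘ ψ) y
        = (mfderiv (𝓡 n) (𝓡 n) c (ψ y)).comp (mfderiv (𝓡 d) (𝓡 n) ψ y) :=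
      mfderiv_comp y (hcs.mdifferentiableAt (by simp)) (h.mdifferentiableAt hyU)
    have h2 : Function.Injective (mfderiv (𝓡 n) (𝓡 n) c (ψ y)) :=
      (isInvertible_mfderiv_extChartAt (mem_extChartAt_source (ψ y))).injective
    have h3 : Function.Injective (mfderiv (𝓡 d) (𝓡 n) (c ∘ ψ) y) := by
      rw [h1]
      exact h2.comp (h.immersion y hyU)
    rwa [mfderiv_eq_fderiv] at h3
  obtain ⟨Λ, hΛ⟩ := LinearMap.exists_leftInverse_of_injective
    (fderiv ℝ (c ∘ ψ) y).toLinearMap (LinearMap.ker_eq_bot.2 hinj)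
  set Λ' := LinearMap.toContinuousLinearMap Λ with hΛ'
  have hG : HasStrictFDerivAt (fun z => Λ' ((c ∘ ψ) z))
      (ContinuousLinearEquiv.refl ℝ (EuclideanSpace ℝ (Fin d)) :
        EuclideanSpace ℝ (Fin d) →L[ℝ] EuclideanSpace ℝ (Fin d)) y := by
    have h1 := Λ'.hasStrictFDerivAt.comp y (hF.hasStrictFDerivAt (by simp))
    convert! h1 using 1
    ext1 v
    exact (LinearMap.congr_fun hΛ v).symm
  have hloc := hG.eventually_left_inverse
  have hinv := hG.to_localInverse.hasFDerivAt.differentiableAt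
  have hev : transition U ψ ψ₁ =ᶠ[𝓝 u]
      (hG.localInverse _ _ _) ∘ (fun z => Λ' ((c ∘ ψ₁) z)) := by
    have h1 := (h.tendsto_transition h₁ hu hu').eventually hloc
    have h2 := (h.isOpen_overlap h₁ h.isOpen subset_rfl).mem_nhds ⟨hu, hu'⟩
    filter_upwards [h1, h2] with z hz hz2
    have h3 := apply_transition hz2.2
    simp only [Function.comp_apply, h3] at hz
    simpa using hz.symm
  refine DifferentiableAt.congr_of_eventuallyEq ?_ hev
  refine DifferentiableAt.comp u ?_ (Λ'.differentiableAt.comp u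
    (hF₁.differentiableAt (by simp)))
  simpa [hyx] using hinv

theorem tangentMapCoord_transition (h : IsLocalParam (n := n) S U ψ)
    (h₁ : IsLocalParam (n := n) S U₁ ψ₁)
    {u : EuclideanSpace ℝ (Fin d)} (hu : u ∈ U₁) (hu' : ψ₁ u ∈ ψ '' U) :
    tangentMapCoord (n := n) ψ₁ u = (tangentMapCoord (n := n) ψ (transition U ψ ψ₁ u)).comp
      (fderiv ℝ (transition U ψ ψ₁) u) := by
  have hd := h.differentiableAt_transition h₁ hu hu'
  have hev : ψ₁ =ᶠ[𝓝 u] ψ ∘ transition U ψ ψ₁ := by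
    filter_upwards [(h.isOpen_overlap h₁ h.isOpen subset_rfl).mem_nhds ⟨hu, hu'⟩] with z hz
    exact (apply_transition hz.2).symm
  have h1 := mfderiv_comp u (h.mdifferentiableAt (transition_mem hu')) hd.mdifferentiableAt
  rw [mfderiv_eq_fderiv] at h1
  exact (hev.mfderiv_eq (I := 𝓡 d) (I' := 𝓡 n)).trans h1

variable [RiemannianBundle (fun x : M => TangentSpace (𝓡 n) x)]

theorem volDensity_transition (h : IsLocalParam (n := n) S U ψ)
    (h₁ : IsLocalParam (n := n) S U₁ ψ₁)
    {u : EuclideanSpace ℝ (Fin d)} (hu : u ∈ U₁) (hu' : ψ₁ u ∈ ψ '' U) :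
    volDensity (n := n) ψ₁ u = |(fderiv ℝ (transition U ψ ψ₁) u).det|
      * volDensity (n := n) ψ (transition U ψ ψ₁ u) := by
  rw [volDensity_eq_tangentVolume, volDensity_eq_tangentVolume,
    h.tangentMapCoord_transition h₁ hu hu', apply_transition hu']
  simpa using tangentVolume_comp (ψ₁ u) (EuclideanSpace.basisFun (Fin d) ℝ).toBasis
    (tangentMapCoord (n := n) ψ (transition U ψ ψ₁ u)) (fderiv ℝ (transition U ψ ψ₁) u)

end IsLocalParam

variable [RiemannianBundle (fun x : M => TangentSpace (𝓡 n) x)]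
  [MeasurableSpace M] [BorelSpace M]

/-- The measure `√ det (⟨∂ᵢψ, ∂ⱼψ⟩) du` on the image of `ψ`. -/
noncomputable def paramMeasure (U : Set (EuclideanSpace ℝ (Fin d)))
    (ψ : EuclideanSpace ℝ (Fin d) → M) : Measure M :=
  Measure.map ψ ((volume.restrict U).withDensity
      fun u => ENNReal.ofReal (volDensity (n := n) ψ u))

theorem ContinuousOn.aemeasurable_withDensity (hU : IsOpen U) (hψ : ContinuousOn ψ U)
    (ρ : EuclideanSpace ℝ (Fin d) → ℝ≥0∞) :
    AEMeasurable ψ ((volume.restrict U).withDensity ρ) :=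
  (hψ.aemeasurable hU.measurableSet).mono_ac (withDensity_absolutelyContinuous _ _)

theorem paramMeasure_apply (hU : IsOpen U) (hψ : ContinuousOn ψ U) {B : Set M}
    (hB : MeasurableSet B) :
    paramMeasure (n := n) U ψ B
      = ∫⁻ u in U ∩ ψ ⁻¹' B, ENNReal.ofReal (volDensity (n := n) ψ u) := by
  rw [paramMeasure, Measure.map_apply_of_aemeasurable (hψ.aemeasurable_withDensity hU _) hB,
    withDensity_apply', Measure.restrict_restrict' hU.measurableSet, inter_comm]

theorem paramMeasure_apply_eq_zero (hU : IsOpen U) (hψ : ContinuousOn ψ U) {B : Set M}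
    (hB : MeasurableSet B) (h : ∀ u ∈ U, ψ u ∉ B) : paramMeasure (n := n) U ψ B = 0 := by
  have : U ∩ ψ ⁻¹' B = ∅ := by
    ext u
    simpa using h u
  rw [paramMeasure_apply hU hψ hB, this]
  simp

theorem ContinuousOn.measurableSet_inter_preimage (hU : IsOpen U) (hψ : ContinuousOn ψ U)
    {B : Set M} (hB : MeasurableSet B) : MeasurableSet (U ∩ ψ ⁻¹' B) := by
  have h := (continuousOn_iff_continuous_domRestrict.1 hψ).measurable hB
  have := hU.measurableSet.subtype_image h
  convert this using 1
  ext u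
  simp [and_comm]

namespace IsLocalParam

theorem paramMeasure_le_volumeOn (h : IsLocalParam (n := n) S U ψ) :
    paramMeasure (n := n) U ψ ≤ volumeOn (n := n) d S :=
  le_iSup (fun p : {p : Set (EuclideanSpace ℝ (Fin d)) × (EuclideanSpace ℝ (Fin d) → M) //
      IsLocalParam (n := n) S p.1 p.2} => paramMeasure (n := n) p.1.1 p.1.2) ⟨(U, ψ), h⟩

theorem volumeOn_le {μ : Measure M} (h : ∀ (U : Set (EuclideanSpace ℝ (Fin d))) ψ,
    IsLocalParam (n := n) S U ψ → paramMeasure (n := n) U ψ ≤ μ) :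
    volumeOn (n := n) d S ≤ μ :=
  iSup_le fun p => h p.1.1 p.1.2 p.2

variable [IsManifold (𝓡 n) ∞ M]

/-- Change of variables along the transition map, which is injective and differentiable on the
relevant set. One inequality suffices, because the volume measure is a supremum over
parametrizations. -/
theorem paramMeasure_restrict_le (h : IsLocalParam (n := n) S U ψ)
    (h₁ : IsLocalParam (n := n) S U₁ ψ₁) (hE : MeasurableSet E) (hES : E ∩ S ⊆ ψ '' U) :
    (paramMeasure (n := n) U₁ ψ₁).restrict E ≤ (paramMeasure (n := n) U ψ).restrict E := by
  refine Measure.le_iff.2 fun B hB => ?_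
  rw [Measure.restrict_apply hB, Measure.restrict_apply hB,
    paramMeasure_apply h.isOpen h.continuousOn (hB.inter hE),
    paramMeasure_apply h₁.isOpen h₁.continuousOn (hB.inter hE)]
  set D := U₁ ∩ ψ₁ ⁻¹' (B ∩ E) with hD
  have hDm : MeasurableSet D :=
    h₁.continuousOn.measurableSet_inter_preimage h₁.isOpen (hB.inter hE)
  have hDi : ∀ u ∈ D, ψ₁ u ∈ ψ '' U := fun u hu => hES ⟨hu.2.2, h₁.mapsTo hu.1⟩
  have hinj : InjOn (transition U ψ ψ₁) D := by
    intro u hu u' hu' huu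
    refine h₁.injOn hu.1 hu'.1 ?_
    rw [← apply_transition (hDi u hu), huu, apply_transition (hDi u' hu')]
  calc ∫⁻ u in D, ENNReal.ofReal (volDensity (n := n) ψ₁ u)
      = ∫⁻ u in D, ENNReal.ofReal |(fderiv ℝ (transition U ψ ψ₁) u).det|
          * ENNReal.ofReal (volDensity (n := n) ψ (transition U ψ ψ₁ u)) := by
        refine setLIntegral_congr_fun hDm fun u hu => ?_
        rw [h.volDensity_transition h₁ hu.1 (hDi u hu), ENNReal.ofReal_mul (abs_nonneg _)]
    _ = ∫⁻ u in transition U ψ ψ₁ '' D, ENNReal.ofReal (volDensity (n := n) ψ u) :=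
        (lintegral_image_eq_lintegral_abs_det_fderiv_mul volume hDm (fun u hu =>
          (h.differentiableAt_transition h₁ hu.1 (hDi u hu)).hasFDerivAt.hasFDerivWithinAt)
          hinj (fun u => ENNReal.ofReal (volDensity (n := n) ψ u))).symm
    _ ≤ _ := by
        refine lintegral_mono_set ?_
        rintro _ ⟨u, hu, rfl⟩
        refine ⟨transition_mem (hDi u hu), ?_⟩
        rw [mem_preimage, apply_transition (hDi u hu)]
        exact hu.2

/-- On a set that is covered by a local parametrization of `S`, the volume measure of `S` is given
by this parametrization. -/
theorem volumeOn_restrict (h : IsLocalParam (n := n) S U ψ) (hE : MeasurableSet E)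
    (hES : E ∩ S ⊆ ψ '' U) :
    (volumeOn (n := n) d S).restrict E = (paramMeasure (n := n) U ψ).restrict E := by
  refine le_antisymm ?_ (Measure.restrict_mono_measure h.paramMeasure_le_volumeOn E)
  -- Rather than restricting a supremum of measures, the proof bounds every competitor by one
  -- measure: the volume itself off `E` and the given parametrization on `E`. Restricting that bound
  -- to `E` removes the first term.
  have key : volumeOn (n := n) d S ≤
      (volumeOn (n := n) d S).restrict Eᶜ + (paramMeasure (n := n) U ψ).restrict E := by
    refine volumeOn_le fun U₁ ψ₁ h₁ => ?_
    rw [← Measure.restrict_add_restrict_compl (μ := paramMeasure (n := n) U₁ ψ₁) hE, add_comm]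
    exact add_le_add (Measure.restrict_mono_measure h₁.paramMeasure_le_volumeOn _)
      (h.paramMeasure_restrict_le h₁ hE hES)
  refine (Measure.restrict_mono_measure key E).trans_eq ?_
  rw [Measure.restrict_add, Measure.restrict_restrict hE, inter_compl_self,
    Measure.restrict_restrict hE, inter_self]
  simp

/-- Continuity of the density is assumed because integrating against `withDensity` requires its
measurability on `U`. -/
theorem lintegral_volumeOn (h : IsLocalParam (n := n) S U ψ) (hE : MeasurableSet E)
    (hES : E ∩ S ⊆ ψ '' U)
    (hρ : ContinuousOn (fun u => volDensity (n := n) ψ u) U)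
    {g : M → ℝ≥0∞} (hg : Measurable g) (hgE : ∀ x, g x ≠ 0 → x ∈ E) :
    ∫⁻ x, g x ∂(volumeOn (n := n) d S)
      = ∫⁻ u in U, ENNReal.ofReal (volDensity (n := n) ψ u) * g (ψ u) := by
  have hsupp : Function.support g ⊆ E := fun x hx => hgE x hx
  rw [← setLIntegral_eq_of_support_subset hsupp, h.volumeOn_restrict hE hES,
    setLIntegral_eq_of_support_subset hsupp, paramMeasure,
    lintegral_map' hg.aemeasurable (h.continuousOn.aemeasurable_withDensity h.isOpen _),
    lintegral_withDensity_eq_lintegral_mul₀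
      (hρ.aemeasurable h.isOpen.measurableSet).ennreal_ofReal]
  · rfl
  · exact hg.comp_aemeasurable (h.continuousOn.aemeasurable h.isOpen.measurableSet)

end IsLocalParam

/-- Every competing measure is carried by `S`, so the restriction of the supremum to `S` is already
an upper bound for all of them. -/
theorem volumeOn_compl_eq_zero (hS : MeasurableSet S) : volumeOn (n := n) d S Sᶜ = 0 := by
  have : volumeOn (n := n) d S ≤ (volumeOn (n := n) d S).restrict S := by
    refine IsLocalParam.volumeOn_le fun U ψ h => ?_
    refine le_trans ?_ (Measure.restrict_mono_measure h.paramMeasure_le_volumeOn S)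
    rw [Measure.restrict_eq_self_of_ae_mem]
    exact paramMeasure_apply_eq_zero h.isOpen h.continuousOn hS.compl
      fun u hu => not_not.2 (h.mapsTo hu)
  refine le_antisymm ((this Sᶜ).trans_eq ?_) bot_le
  rw [Measure.restrict_apply hS.compl, compl_inter_self, measure_empty]

end LocalParam

/-! ### Continuity of the volume densities -/

section Continuity

set_option linter.unusedSectionVars false

variable {n d : ℕ} {M : Type*} [TopologicalSpace M] [ChartedSpace (EuclideanSpace ℝ (Fin n)) M]
  [RiemannianBundle (fun x : M => TangentSpace (𝓡 n) x)]  [IsManifold (𝓡 n) ∞ M]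
    [IsContMDiffRiemannianBundle (𝓡 n) ∞ (EuclideanSpace ℝ (Fin n))
      (fun x : M => TangentSpace (𝓡 n) x)]
  {E : Type*} [NormedAddCommGroup E] [NormedSpace ℝ E] {ι : Type*} [Fintype ι] [DecidableEq ι]

variable (n M) in
theorem IsContMDiffRiemannianBundle.isContinuousRiemannianBundle :
    IsContinuousRiemannianBundle (EuclideanSpace ℝ (Fin n))
      (fun x : M => TangentSpace (𝓡 n) x) := by
  obtain ⟨g, hg, h⟩ := IsContMDiffRiemannianBundle.exists_contMDiff (IB := 𝓡 n) (n := ∞)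
    (F := EuclideanSpace ℝ (Fin n)) (E := fun x : M => TangentSpace (𝓡 n) x)
  exact ⟨g, hg.continuous, h⟩

/-- The derivatives of `ψ` in fixed directions are continuous sections of the tangent bundle along
`ψ`, and the metric is continuous; hence so are the Gram entries and the root of their determinant.
-/
theorem ContMDiffOn.continuousOn_tangentVolume {O : Set E} {ψ : E → M} (hO : IsOpen O)
    (hψ : ContMDiffOn 𝓘(ℝ, E) (𝓡 n) ∞ ψ O) (v : ι → E) :
    ContinuousOn (fun u => tangentVolume (ψ u) fun i => tangentMapCoord (n := n) ψ u (v i)) O := by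
  have hsec : ∀ i, ContinuousOn (fun u => (⟨ψ u, mfderiv 𝓘(ℝ, E) (𝓡 n) ψ u (v i)⟩ :
      TangentBundle (𝓡 n) M)) O := by
    intro i
    have h1 := hψ.continuousOn_tangentMapWithin (by simp) hO.uniqueMDiffOn
    have h2 : Continuous (fun u : E => (⟨u, v i⟩ : TangentBundle 𝓘(ℝ, E) E)) :=
      (tangentBundleModelSpaceHomeomorph 𝓘(ℝ, E)).symm.continuous.comp
        (continuous_id.prodMk continuous_const)
    refine (h1.comp h2.continuousOn fun u hu => hu).congr fun u hu => ?_
    simp only [Function.comp_apply, tangentMapWithin, mfderivWithin_of_isOpen hO hu]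
  unfold tangentVolume gramVolume
  refine (ContinuousOn.sqrt ?_)
  refine Continuous.comp_continuousOn (continuous_id.matrix_det) ?_
  refine continuousOn_pi.2 fun i => continuousOn_pi.2 fun j => ?_
  have := IsContMDiffRiemannianBundle.isContinuousRiemannianBundle n M
  exact (hsec i).inner_bundle (hsec j)

end Continuity

/-! ### Jacobian factors in terms of volumes -/

section JacobianFormula

variable {k l m : ℕ} {α β γ : Type*} [Fintype α] [DecidableEq α] [Fintype β] [DecidableEq β]
  [Fintype γ] [DecidableEq γ]
  {𝒳 : Type*} [TopologicalSpace 𝒳] [ChartedSpace (EuclideanSpace ℝ (Fin k)) 𝒳]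
  [RiemannianBundle (fun x : 𝒳 => TangentSpace (𝓡 k) x)]
  {𝒲 : Type*} [TopologicalSpace 𝒲] [ChartedSpace (EuclideanSpace ℝ (Fin m)) 𝒲]
  [RiemannianBundle (fun x : 𝒲 => TangentSpace (𝓡 m) x)]
  {𝒯 : Type*} [TopologicalSpace 𝒯] [ChartedSpace (EuclideanSpace ℝ (Fin l)) 𝒯]
  [RiemannianBundle (fun x : 𝒯 => TangentSpace (𝓡 l) x)]

theorem tangentVolume_pos (x : 𝒳) {v : α → EuclideanSpace ℝ (Fin k)}
    (hv : LinearIndependent ℝ v) : 0 < tangentVolume x v :=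
  gramVolume_pos (E := TangentSpace (𝓡 k) x) hv

theorem tangentVolume_comp_equiv (x : 𝒳) (v : α → EuclideanSpace ℝ (Fin k)) (σ : β ≃ α) :
    tangentVolume x (fun i => v (σ i)) = tangentVolume x v :=
  gramVolume_comp_equiv (E := TangentSpace (𝓡 k) x) v σ

theorem jac_eq_tangentVolume (W : 𝒳 → 𝒲) (x : 𝒳)
    (u : Module.Basis (α ⊕ β) ℝ (EuclideanSpace ℝ (Fin k)))
    (v : Module.Basis α ℝ (EuclideanSpace ℝ (Fin m)))
    (hl : ∀ i, mfderiv (𝓡 k) (𝓡 m) W x (u (Sum.inl i)) = v i)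
    (hr : ∀ j, mfderiv (𝓡 k) (𝓡 m) W x (u (Sum.inr j)) = 0) :
    jac (k := k) (m := m) W x = ENNReal.ofReal
      (tangentVolume x u / (tangentVolume (W x) v * tangentVolume x fun j => u (Sum.inr j))) :=
  jacFactor_eq_gramVolume (E := TangentSpace (𝓡 k) x) (F := TangentSpace (𝓡 m) (W x))
    (mfderiv (𝓡 k) (𝓡 m) W x).toLinearMap u v hl hr

/-- The basis is split into directions seen by `T` alone, directions seen by `W` alone, and
directions tangent to the joint fibre. -/
theorem jacPair_eq_tangentVolume (T : 𝒳 → 𝒯) (W : 𝒳 → 𝒲) (x : 𝒳)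
    (u : Module.Basis ((γ ⊕ α) ⊕ β) ℝ (EuclideanSpace ℝ (Fin k)))
    (t : Module.Basis γ ℝ (EuclideanSpace ℝ (Fin l)))
    (v : Module.Basis α ℝ (EuclideanSpace ℝ (Fin m)))
    (hTt : ∀ i, mfderiv (𝓡 k) (𝓡 l) T x (u (Sum.inl (Sum.inl i))) = t i)
    (hTv : ∀ i, mfderiv (𝓡 k) (𝓡 l) T x (u (Sum.inl (Sum.inr i))) = 0)
    (hT : ∀ j, mfderiv (𝓡 k) (𝓡 l) T x (u (Sum.inr j)) = 0)
    (hWt : ∀ i, mfderiv (𝓡 k) (𝓡 m) W x (u (Sum.inl (Sum.inl i))) = 0)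
    (hWv : ∀ i, mfderiv (𝓡 k) (𝓡 m) W x (u (Sum.inl (Sum.inr i))) = v i)
    (hW : ∀ j, mfderiv (𝓡 k) (𝓡 m) W x (u (Sum.inr j)) = 0) :
    jacPair (k := k) (l := l) (m := m) T W x = ENNReal.ofReal
      (tangentVolume x u / (tangentVolume (T x) t * tangentVolume (W x) v
        * tangentVolume x fun j => u (Sum.inr j))) := by
  let t' : Module.Basis γ ℝ (TangentSpace (𝓡 l) (T x)) := t
  let v' : Module.Basis α ℝ (TangentSpace (𝓡 m) (W x)) := v
  let b : Module.Basis (γ ⊕ α) ℝ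
      (WithLp 2 (TangentSpace (𝓡 l) (T x) × TangentSpace (𝓡 m) (W x))) :=
    (t'.prod v').map (WithLp.linearEquiv 2 ℝ _).symm
  have hb : (b : γ ⊕ α → _) = Sum.elim (fun i => WithLp.toLp 2 (t' i, 0))
      (fun j => WithLp.toLp 2 (0, v' j)) := by
    ext1 (i | i)
    · simp [b]
    · simp [b]
  have key := jacFactor_eq_gramVolume (E := TangentSpace (𝓡 k) x)
    (pairDeriv (k := k) (l := l) (m := m) T W x) u b ?_ ?_
  · rw [hb, gramVolume_prod] at key
    exact key
  · rintro (i | i)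
    · rw [hb]
      exact congrArg (WithLp.toLp 2) (Prod.ext (hTt i) (hWt i))
    · rw [hb]
      exact congrArg (WithLp.toLp 2) (Prod.ext (hTv i) (hWv i))
  · intro j
    exact congrArg (WithLp.toLp 2) (Prod.ext (hT j) (hW j))

end JacobianFormula

/-! ### Slices of a chart -/

section Slice

open Set Filter Topology

variable {n d : ℕ} {M : Type*} [TopologicalSpace M] [ChartedSpace (EuclideanSpace ℝ (Fin n)) M]
  {E : Type*} [NormedAddCommGroup E] [NormedSpace ℝ E]

theorem tangentMapCoord_comp {F : Type*} [NormedAddCommGroup F] [NormedSpace ℝ F]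
    {Φ : E → M} {ι : F → E} {L : F →L[ℝ] E} {u : F}
    (hΦ : MDifferentiableAt 𝓘(ℝ, E) (𝓡 n) Φ (ι u)) (hι : HasFDerivAt ι L u) :
    tangentMapCoord (n := n) (Φ ∘ ι) u = (tangentMapCoord (n := n) Φ (ι u)).comp L := by
  have h1 := mfderiv_comp u hΦ hι.differentiableAt.mdifferentiableAt
  rw [mfderiv_eq_fderiv, hι.fderiv] at h1
  exact h1

/-- When `S` is, inside the chart, the slice `range ι`, restricting the chart to the slice
parametrizes `S`. Relative openness of images comes from `ι` being inducing: an open set of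
parameters is the trace of an open set of the ambient chart domain. -/
theorem OpenPartialHomeomorph.isLocalParam_slice (Φ : OpenPartialHomeomorph E M)
    (hΦ : ContMDiffOn 𝓘(ℝ, E) (𝓡 n) ∞ Φ Φ.source)
    (hinj : ∀ p ∈ Φ.source, Function.Injective (tangentMapCoord (n := n) Φ p))
    {ι : EuclideanSpace ℝ (Fin d) → E} {L : EuclideanSpace ℝ (Fin d) →L[ℝ] E}
    (hι : ContDiff ℝ ∞ ι) (hL : ∀ u, HasFDerivAt ι L u) (hLi : Function.Injective L)
    (hemb : IsEmbedding ι) {S : Set M} (hS : ∀ p ∈ Φ.source, Φ p ∈ S ↔ p ∈ range ι) :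
    IsLocalParam (n := n) S (ι ⁻¹' Φ.source) (Φ ∘ ι) where
  isOpen := Φ.open_source.preimage hι.continuous
  smooth := hΦ.comp hι.contMDiff.contMDiffOn fun _ h => h
  injOn := Φ.injOn.comp hemb.injective.injOn fun _ h => h
  immersion u hu := by
    have h := tangentMapCoord_comp (n := n) (Φ := Φ) (u := u)
      ((hΦ.contMDiffAt (Φ.open_source.mem_nhds hu)).mdifferentiableAt (by simp)) (hL u)
    have h1 : Function.Injective (tangentMapCoord (n := n) (Φ ∘ ι) u) := by
      rw [h]
      exact (hinj _ hu).comp hLi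
    exact h1
  mapsTo u hu := (hS _ hu).2 ⟨u, rfl⟩
  isOpen_image V hV hVo := by
    obtain ⟨O, hO, rfl⟩ := hemb.isInducing.isOpen_iff.1 hVo
    refine ⟨Φ '' (O ∩ Φ.source), Φ.isOpen_image_of_subset_source (hO.inter Φ.open_source)
      inter_subset_right, ?_⟩
    ext x
    constructor
    · rintro ⟨u, hu, rfl⟩
      exact ⟨⟨ι u, ⟨hu, hV hu⟩, rfl⟩, (hS _ (hV hu)).2 ⟨u, rfl⟩⟩
    · rintro ⟨⟨p, ⟨hpO, hp⟩, rfl⟩, hpS⟩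
      obtain ⟨u, rfl⟩ := (hS _ hp).1 hpS
      exact ⟨u, hpO, rfl⟩

end Slice

/-! ### Charts in which a submersion is a projection -/

section Adapted

open Set Filter Topology

/-- `C` extends linear coordinates on `ker A` by means of a projection onto the kernel. Together
with `A` it then has trivial kernel. -/
theorem ContinuousLinearMap.exists_injective_prod {E F : Type*} [NormedAddCommGroup E]
    [NormedSpace ℝ E] [FiniteDimensional ℝ E] [NormedAddCommGroup F] [NormedSpace ℝ F]
    [FiniteDimensional ℝ F] {r : ℕ} (A : E →L[ℝ] F) (hA : Function.Surjective A)
    (hr : Module.finrank ℝ E = Module.finrank ℝ F + r) :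
    ∃ C : E →L[ℝ] EuclideanSpace ℝ (Fin r), ∀ v, A v = 0 → C v = 0 → v = 0 := by
  have hrank : Module.finrank ℝ (LinearMap.ker A.toLinearMap) = r := by
    have h1 := A.toLinearMap.finrank_range_add_finrank_ker
    rw [LinearMap.range_eq_top.2 hA, finrank_top] at h1
    omega
  obtain ⟨q, hq⟩ := LinearMap.exists_leftInverse_of_injective
    (LinearMap.ker A.toLinearMap).subtype (Submodule.ker_subtype _)
  let e : LinearMap.ker A.toLinearMap ≃ₗ[ℝ] EuclideanSpace ℝ (Fin r) :=
    LinearEquiv.ofFinrankEq _ _ (by rw [hrank, finrank_euclideanSpace_fin])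
  refine ⟨LinearMap.toContinuousLinearMap (e.toLinearMap ∘ₗ q), fun v hv hC => ?_⟩
  have h1 : q v = 0 := e.map_eq_zero_iff.1 hC
  have h2 := LinearMap.congr_fun hq ⟨v, hv⟩
  simp only [LinearMap.comp_apply, Submodule.subtype_apply, h1] at h2
  exact (congrArg Subtype.val h2).symm

variable {k l m r : ℕ}
  {𝒳 : Type*} [TopologicalSpace 𝒳] [ChartedSpace (EuclideanSpace ℝ (Fin k)) 𝒳]
  {𝒲 : Type*} [TopologicalSpace 𝒲] [ChartedSpace (EuclideanSpace ℝ (Fin m)) 𝒲]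
  {𝒯 : Type*} [TopologicalSpace 𝒯] [ChartedSpace (EuclideanSpace ℝ (Fin l)) 𝒯]

/-- The inverse `Φ` of a chart of `𝒳` in which `T` and `W` are the projections to the first and to
the second factor, with respect to the inverses `τ` and `σ` of charts of `𝒯` and `𝒲`. -/
structure IsAdaptedChart (T : 𝒳 → 𝒯) (W : 𝒳 → 𝒲)
    (Φ : OpenPartialHomeomorph
      (EuclideanSpace ℝ (Fin l) × EuclideanSpace ℝ (Fin m) × EuclideanSpace ℝ (Fin r)) 𝒳)
    (τ : OpenPartialHomeomorph (EuclideanSpace ℝ (Fin l)) 𝒯)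
    (σ : OpenPartialHomeomorph (EuclideanSpace ℝ (Fin m)) 𝒲) : Prop where
  smooth : ContMDiffOn 𝓘(ℝ, EuclideanSpace ℝ (Fin l) × EuclideanSpace ℝ (Fin m) ×
    EuclideanSpace ℝ (Fin r)) (𝓡 k) ∞ Φ Φ.source
  injective : ∀ p ∈ Φ.source, Function.Injective (tangentMapCoord (n := k) Φ p)
  smooth_left : ContMDiffOn (𝓡 l) (𝓡 l) ∞ τ τ.source
  injective_left : ∀ a ∈ τ.source, Function.Injective (tangentMapCoord (n := l) τ a)
  smooth_right : ContMDiffOn (𝓡 m) (𝓡 m) ∞ σ σ.source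
  injective_right : ∀ b ∈ σ.source, Function.Injective (tangentMapCoord (n := m) σ b)
  fst_mem : ∀ p ∈ Φ.source, p.1 ∈ τ.source
  snd_mem : ∀ p ∈ Φ.source, p.2.1 ∈ σ.source
  apply_left : ∀ p ∈ Φ.source, T (Φ p) = τ p.1
  apply_right : ∀ p ∈ Φ.source, W (Φ p) = σ p.2.1

variable [IsManifold (𝓡 k) ∞ 𝒳] [IsManifold (𝓡 m) ∞ 𝒲] [IsManifold (𝓡 l) ∞ 𝒯]

omit [IsManifold (𝓡 m) ∞ 𝒲] [IsManifold (𝓡 l) ∞ 𝒯] in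
theorem injective_tangentMapCoord_chartAt_symm (x : 𝒳) {y : EuclideanSpace ℝ (Fin k)}
    (hy : y ∈ (chartAt (EuclideanSpace ℝ (Fin k)) x).target) :
    Function.Injective
      (tangentMapCoord (n := k) (chartAt (EuclideanSpace ℝ (Fin k)) x).symm y) :=
  (mdifferentiable_chart (I := 𝓡 k) x).symm.mfderiv_injective hy

/-- The submersion theorem for `(T, W)`: in charts, the pair is completed by a linear map `C` that
is injective on the kernel of its derivative, and the resulting local diffeomorphism is inverted. -/
theorem exists_isAdaptedChart (hk : k = l + m + r) {T : 𝒳 → 𝒯} {W : 𝒳 → 𝒲}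
    (hT : ContMDiff (𝓡 k) (𝓡 l) ∞ T) (hW : ContMDiff (𝓡 k) (𝓡 m) ∞ W) {x : 𝒳}
    (hsurj : ∀ (a : TangentSpace (𝓡 l) (T x)) (b : TangentSpace (𝓡 m) (W x)),
      ∃ v, mfderiv (𝓡 k) (𝓡 l) T x v = a ∧ mfderiv (𝓡 k) (𝓡 m) W x v = b) :
    ∃ (Φ : OpenPartialHomeomorph
        (EuclideanSpace ℝ (Fin l) × EuclideanSpace ℝ (Fin m) × EuclideanSpace ℝ (Fin r)) 𝒳)
      (τ : OpenPartialHomeomorph (EuclideanSpace ℝ (Fin l)) 𝒯)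
      (σ : OpenPartialHomeomorph (EuclideanSpace ℝ (Fin m)) 𝒲),
      x ∈ Φ.target ∧ IsAdaptedChart (k := k) T W Φ τ σ := by
  set eX := chartAt (EuclideanSpace ℝ (Fin k)) x with heX
  set eT := chartAt (EuclideanSpace ℝ (Fin l)) (T x) with heT
  set eW := chartAt (EuclideanSpace ℝ (Fin m)) (W x) with heW
  set D := eX.target ∩ eX.symm ⁻¹' (T ⁻¹' eT.source ∩ W ⁻¹' eW.source) with hD
  have hDo : IsOpen D := eX.symm.isOpen_inter_preimage
    ((eT.open_source.preimage hT.continuous).inter (eW.open_source.preimage hW.continuous))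
  set y₀ := eX x with hy₀
  have hxs : x ∈ eX.source := mem_chart_source _ x
  have hy₀t : y₀ ∈ eX.target := eX.map_source hxs
  have hxy : eX.symm y₀ = x := eX.left_inv hxs
  have hy₀D : y₀ ∈ D := by
    refine ⟨hy₀t, ?_⟩
    simp only [mem_preimage, mem_inter_iff, hxy]
    exact ⟨mem_chart_source _ _, mem_chart_source _ _⟩
  have hsX : ContMDiffOn (𝓡 k) (𝓡 k) ∞ eX.symm eX.target := contMDiffOn_chart_symm
  have hsT : ContMDiffOn (𝓡 l) (𝓡 l) ∞ eT eT.source := contMDiffOn_chart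
  have hsW : ContMDiffOn (𝓡 m) (𝓡 m) ∞ eW eW.source := contMDiffOn_chart
  have hF : ContDiffOn ℝ ∞ (fun y => eT (T (eX.symm y))) D := contMDiffOn_iff_contDiffOn.1
    (hsT.comp (hT.comp_contMDiffOn (hsX.mono inter_subset_left)) fun y hy => hy.2.1)
  have hG : ContDiffOn ℝ ∞ (fun y => eW (W (eX.symm y))) D := contMDiffOn_iff_contDiffOn.1
    (hsW.comp (hW.comp_contMDiffOn (hsX.mono inter_subset_left)) fun y hy => hy.2.2)
  set A : EuclideanSpace ℝ (Fin k) →L[ℝ] EuclideanSpace ℝ (Fin l) × EuclideanSpace ℝ (Fin m) :=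
    (fderiv ℝ (fun y => eT (T (eX.symm y))) y₀).prod
      (fderiv ℝ (fun y => eW (W (eX.symm y))) y₀) with hA
  have hmX : MDifferentiableAt (𝓡 k) (𝓡 k) eX.symm y₀ :=
    (hsX.contMDiffAt (eX.open_target.mem_nhds hy₀t)).mdifferentiableAt (by simp)
  have hAs : Function.Surjective A := by
    rintro ⟨a, b⟩
    -- The tangent spaces depend on the base point, so surjectivity is transported from `x` to the
    -- equal point `eX.symm y₀` before the chain rule is used.
    have hsurj' : ∀ (a : TangentSpace (𝓡 l) (T (eX.symm y₀)))
        (b : TangentSpace (𝓡 m) (W (eX.symm y₀))),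
        ∃ v, mfderiv (𝓡 k) (𝓡 l) T (eX.symm y₀) v = a ∧
          mfderiv (𝓡 k) (𝓡 m) W (eX.symm y₀) v = b := by
      rw [hxy]
      exact hsurj
    have hmT := (hT.mdifferentiable (by simp)) (eX.symm y₀)
    have hmW := (hW.mdifferentiable (by simp)) (eX.symm y₀)
    have hmeT := (mdifferentiable_chart (I := 𝓡 l) (T x)).mdifferentiableAt hy₀D.2.1
    have hmeW := (mdifferentiable_chart (I := 𝓡 m) (W x)).mdifferentiableAt hy₀D.2.2
    obtain ⟨a', ha'⟩ := (mdifferentiable_chart (I := 𝓡 l) (T x)).mfderiv_surjective hy₀D.2.1 a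
    obtain ⟨b', hb'⟩ := (mdifferentiable_chart (I := 𝓡 m) (W x)).mfderiv_surjective hy₀D.2.2 b
    obtain ⟨v, hv1, hv2⟩ := hsurj' a' b'
    obtain ⟨v', rfl⟩ := (mdifferentiable_chart (I := 𝓡 k) x).symm.mfderiv_surjective hy₀t v
    have c1 := mfderiv_comp y₀ (g := fun z => eT (T z)) (hmeT.comp _ hmT) hmX
    have c2 := mfderiv_comp (eX.symm y₀) (g := eT) hmeT hmT
    have c3 := mfderiv_comp y₀ (g := fun z => eW (W z)) (hmeW.comp _ hmW) hmX
    have c4 := mfderiv_comp (eX.symm y₀) (g := eW) hmeW hmW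
    refine ⟨v', Prod.ext ?_ ?_⟩
    · have h1 : fderiv ℝ (fun y => eT (T (eX.symm y))) y₀ v' = a := by
        rw [← mfderiv_eq_fderiv]
        refine (DFunLike.congr_fun c1 v').trans ((DFunLike.congr_fun c2 _).trans ?_)
        exact (congrArg (mfderiv (𝓡 l) (𝓡 l) eT (T (eX.symm y₀))) hv1).trans ha'
      exact h1
    · have h1 : fderiv ℝ (fun y => eW (W (eX.symm y))) y₀ v' = b := by
        rw [← mfderiv_eq_fderiv]
        refine (DFunLike.congr_fun c3 v').trans ((DFunLike.congr_fun c4 _).trans ?_)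
        exact (congrArg (mfderiv (𝓡 m) (𝓡 m) eW (W (eX.symm y₀))) hv2).trans hb'
      exact h1
  obtain ⟨C, hC⟩ := A.exists_injective_prod (r := r) hAs (by simp [hk])
  set H : EuclideanSpace ℝ (Fin k) →
      EuclideanSpace ℝ (Fin l) × EuclideanSpace ℝ (Fin m) × EuclideanSpace ℝ (Fin r) :=
    fun y => (eT (T (eX.symm y)), eW (W (eX.symm y)), C y) with hH
  have hHs : ContDiffOn ℝ ∞ H D := hF.prodMk (hG.prodMk C.contDiff.contDiffOn)
  have hHd : HasFDerivAt H ((fderiv ℝ (fun y => eT (T (eX.symm y))) y₀).prod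
      ((fderiv ℝ (fun y => eW (W (eX.symm y))) y₀).prod C)) y₀ :=
    ((hF.contDiffAt (hDo.mem_nhds hy₀D)).differentiableAt (by simp)).hasFDerivAt.prodMk
      (((hG.contDiffAt (hDo.mem_nhds hy₀D)).differentiableAt (by simp)).hasFDerivAt.prodMk
        C.hasFDerivAt)
  set H' := (fderiv ℝ (fun y => eT (T (eX.symm y))) y₀).prod
      ((fderiv ℝ (fun y => eW (W (eX.symm y))) y₀).prod C) with hH'
  have hinj : Function.Injective H'.toLinearMap := by
    refine (injective_iff_map_eq_zero _).2 fun v hv => hC v ?_ ?_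
    · exact Prod.ext (congrArg (fun p : EuclideanSpace ℝ (Fin l) × EuclideanSpace ℝ (Fin m) ×
        EuclideanSpace ℝ (Fin r) => p.1) hv) (congrArg (fun p : EuclideanSpace ℝ (Fin l) ×
        EuclideanSpace ℝ (Fin m) × EuclideanSpace ℝ (Fin r) => p.2.1) hv)
    · exact congrArg (fun p : EuclideanSpace ℝ (Fin l) × EuclideanSpace ℝ (Fin m) ×
        EuclideanSpace ℝ (Fin r) => p.2.2) hv
  let e₀ := (LinearMap.linearEquivOfInjective H'.toLinearMap hinj
    (by simp [hk, add_assoc])).toContinuousLinearEquiv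
  have he₀ : (e₀ : _ →L[ℝ] _) = H' := by ext1 v; rfl
  have hcd : ContDiffAt ℝ ∞ H y₀ := hHs.contDiffAt (hDo.mem_nhds hy₀D)
  have hd₀ : HasFDerivAt H (e₀ : _ →L[ℝ] _) y₀ := by rw [he₀]; exact hHd
  set K := hcd.toOpenPartialHomeomorph H hd₀ (by simp) with hK
  have hKc : (K : _ → _) = H := hcd.toOpenPartialHomeomorph_coe hd₀ (by simp)
  -- The inverse must be smooth with injective derivative on its whole domain, not only at the image
  -- of `y₀`. Invertible operators form an open set, so it is enough to shrink to the points where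
  -- the derivative of `H` is invertible.
  set D' := D ∩ fderiv ℝ H ⁻¹' range (fun f : EuclideanSpace ℝ (Fin k) ≃L[ℝ]
    EuclideanSpace ℝ (Fin l) × EuclideanSpace ℝ (Fin m) × EuclideanSpace ℝ (Fin r) =>
    f.toContinuousLinearMap) with hD'
  have hD'o : IsOpen D' := (hHs.continuousOn_fderiv_of_isOpen hDo (by simp)).isOpen_inter_preimage
    hDo ContinuousLinearEquiv.isOpen
  have hy₀D' : y₀ ∈ D' := ⟨hy₀D, e₀, hd₀.fderiv.symm⟩
  set R := K.restrOpen D' hD'o with hR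
  have hRs : R.source = K.source ∩ D' := K.restrOpen_source D' hD'o
  have hRc : (R : _ → _) = H := hKc
  have hy₀R : y₀ ∈ R.source := by
    rw [hRs]
    exact ⟨hcd.mem_toOpenPartialHomeomorph_source hd₀ (by simp), hy₀D'⟩
  have hRd : ∀ p ∈ R.target, ∃ f : EuclideanSpace ℝ (Fin k) ≃L[ℝ]
      EuclideanSpace ℝ (Fin l) × EuclideanSpace ℝ (Fin m) × EuclideanSpace ℝ (Fin r),
      HasFDerivAt R f.toContinuousLinearMap (R.symm p) := by
    intro p hp
    have h1 : R.symm p ∈ D' := by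
      have := R.map_target hp
      rw [hRs] at this
      exact this.2
    obtain ⟨f, hf⟩ := h1.2
    refine ⟨f, ?_⟩
    have hf' : f.toContinuousLinearMap = fderiv ℝ H (R.symm p) := hf
    rw [hf', hRc]
    exact ((hHs.contDiffAt (hDo.mem_nhds h1.1)).differentiableAt (by simp)).hasFDerivAt
  have hRD : ∀ p ∈ R.target, R.symm p ∈ D := by
    intro p hp
    have := R.map_target hp
    rw [hRs] at this
    exact this.2.1
  have hRsm : ContDiffOn ℝ ∞ R.symm R.target := by
    intro p hp
    obtain ⟨f, hf⟩ := hRd p hp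
    refine (R.contDiffAt_symm hp hf ?_).contDiffWithinAt
    rw [hRc]
    exact hHs.contDiffAt (hDo.mem_nhds (hRD p hp))
  have hsub : ∀ p ∈ (R.symm.trans eX.symm).source, p ∈ R.target ∧ R.symm p ∈ eX.target := by
    intro p hp
    simpa [OpenPartialHomeomorph.trans_source] using hp
  have hRp : ∀ p ∈ R.target, H (R.symm p) = p := by
    intro p hp
    rw [← hRc]
    exact R.right_inv hp
  refine ⟨R.symm.trans eX.symm, eT.symm, eW.symm, ?_, ?_⟩
  · simp only [OpenPartialHomeomorph.trans_target, OpenPartialHomeomorph.symm_target,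
      OpenPartialHomeomorph.symm_symm, mem_inter_iff, mem_preimage]
    exact ⟨hxs, hy₀R⟩
  · refine ⟨?_, ?_, contMDiffOn_chart_symm, fun a ha => ?_, contMDiffOn_chart_symm,
      fun b hb => ?_, ?_, ?_, ?_, ?_⟩
    · exact hsX.comp (hRsm.contMDiffOn.mono fun p hp => (hsub p hp).1) fun p hp => (hsub p hp).2
    · intro p hp
      obtain ⟨hp1, hp2⟩ := hsub p hp
      obtain ⟨f, hf⟩ := hRd p hp1
      have h1 := tangentMapCoord_comp (n := k) (Φ := eX.symm) (ι := R.symm) (u := p)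
        ((hsX.contMDiffAt (eX.open_target.mem_nhds hp2)).mdifferentiableAt (by simp))
        (R.hasFDerivAt_symm hp1 hf)
      have h2 : (R.symm.trans eX.symm : _ → _) = eX.symm ∘ R.symm := rfl
      rw [h2, h1]
      exact (injective_tangentMapCoord_chartAt_symm x hp2).comp f.symm.injective
    · exact injective_tangentMapCoord_chartAt_symm (T x) ha
    · exact injective_tangentMapCoord_chartAt_symm (W x) hb
    · intro p hp
      have h1 := hRp p (hsub p hp).1
      have h2 := (hRD p (hsub p hp).1).2.1
      rw [← h1]
      exact eT.map_source h2
    · intro p hp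
      have h1 := hRp p (hsub p hp).1
      have h2 := (hRD p (hsub p hp).1).2.2
      rw [← h1]
      exact eW.map_source h2
    · intro p hp
      have h1 := hRp p (hsub p hp).1
      have h2 := (hRD p (hsub p hp).1).2.1
      conv_rhs => rw [← h1]
      exact (eT.left_inv h2).symm
    · intro p hp
      have h1 := hRp p (hsub p hp).1
      have h2 := (hRD p (hsub p hp).1).2.2
      conv_rhs => rw [← h1]
      exact (eW.left_inv h2).symm

end Adapted

/-! ### The Jacobian factors in an adapted chart -/

section AdaptedJacobian

open Set Filter Topology

set_option linter.unusedSectionVars false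

variable {k l m r : ℕ}
  {𝒳 : Type*} [TopologicalSpace 𝒳] [ChartedSpace (EuclideanSpace ℝ (Fin k)) 𝒳]
  {𝒲 : Type*} [TopologicalSpace 𝒲] [ChartedSpace (EuclideanSpace ℝ (Fin m)) 𝒲]
  {𝒯 : Type*} [TopologicalSpace 𝒯] [ChartedSpace (EuclideanSpace ℝ (Fin l)) 𝒯]

/-- The plain product carries the sup norm, so the splitting is factored through the Euclidean
product: two linear isometries followed by the volume-preserving change of norm. -/
theorem EuclideanSpace.volume_preserving_finAddEquivProd :
    MeasurePreserving (EuclideanSpace.finAddEquivProd (𝕜 := ℝ) (n := l) (m := r)) :=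
  ((WithLp.volume_preserving_ofLp (EuclideanSpace ℝ (Fin l)) (EuclideanSpace ℝ (Fin r))).comp
    (PiLp.sumPiLpEquivProdLpPiLp (𝕜 := ℝ) 2
      (fun _ : Fin l ⊕ Fin r => ℝ)).measurePreserving).comp
    (LinearIsometryEquiv.piLpCongrLeft 2 ℝ ℝ
      (finSumFinEquiv (m := l) (n := r)).symm).measurePreserving

variable (l m r) in
/-- The linear part of the parametrizations `(a, z) ↦ (a, b, z)`. -/
noncomputable def sliceMap : EuclideanSpace ℝ (Fin (l + r)) →L[ℝ]
    EuclideanSpace ℝ (Fin l) × EuclideanSpace ℝ (Fin m) × EuclideanSpace ℝ (Fin r) :=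
  ((ContinuousLinearMap.fst ℝ _ _).prod
    ((0 : _ →L[ℝ] EuclideanSpace ℝ (Fin m)).prod (ContinuousLinearMap.snd ℝ _ _))).comp
    (EuclideanSpace.finAddEquivProd (𝕜 := ℝ) (n := l) (m := r)).toContinuousLinearMap

theorem sliceMap_apply (u : EuclideanSpace ℝ (Fin (l + r))) :
    sliceMap l m r u = ((EuclideanSpace.finAddEquivProd u).1, 0,
      (EuclideanSpace.finAddEquivProd u).2) := rfl

theorem finAddEquivProd_single_left (i : Fin l) :
    EuclideanSpace.finAddEquivProd (𝕜 := ℝ)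
      (EuclideanSpace.single (finSumFinEquiv (m := l) (n := r) (Sum.inl i)) (1 : ℝ))
      = (EuclideanSpace.single i (1 : ℝ), 0) := by
  ext j <;> simp

theorem finAddEquivProd_single_right (i : Fin r) :
    EuclideanSpace.finAddEquivProd (𝕜 := ℝ)
      (EuclideanSpace.single (finSumFinEquiv (m := l) (n := r) (Sum.inr i)) (1 : ℝ))
      = (0, EuclideanSpace.single i (1 : ℝ)) := by
  ext j <;> simp

variable (l m r) in
/-- The standard basis of the domain of an adapted chart. -/
noncomputable def tripleBasis : Module.Basis (Fin l ⊕ Fin m ⊕ Fin r) ℝ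
    (EuclideanSpace ℝ (Fin l) × EuclideanSpace ℝ (Fin m) × EuclideanSpace ℝ (Fin r)) :=
  (EuclideanSpace.basisFun (Fin l) ℝ).toBasis.prod
    ((EuclideanSpace.basisFun (Fin m) ℝ).toBasis.prod (EuclideanSpace.basisFun (Fin r) ℝ).toBasis)

theorem tripleBasis_inl (i : Fin l) :
    tripleBasis l m r (Sum.inl i) = (EuclideanSpace.single i 1, 0, 0) := by
  simp [tripleBasis, Prod.ext_iff]

theorem tripleBasis_inr_inl (i : Fin m) :
    tripleBasis l m r (Sum.inr (Sum.inl i)) = (0, EuclideanSpace.single i 1, 0) := by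
  simp [tripleBasis]

theorem tripleBasis_inr_inr (i : Fin r) :
    tripleBasis l m r (Sum.inr (Sum.inr i)) = (0, 0, EuclideanSpace.single i 1) := by
  simp [tripleBasis]

/-- The basis that consists of the partial derivatives of a parametrization. -/
theorem exists_basis_of_injective {ι : Type*} {E : Type*} [NormedAddCommGroup E]
    [NormedSpace ℝ E] {n : ℕ} (b : Module.Basis ι ℝ E) [Fintype ι] (hι : Fintype.card ι = n)
    (D : E →L[ℝ] EuclideanSpace ℝ (Fin n)) (hD : Function.Injective D) :
    ∃ u : Module.Basis ι ℝ (EuclideanSpace ℝ (Fin n)), ∀ i, u i = D (b i) := by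
  have : FiniteDimensional ℝ E := b.finiteDimensional_of_finite
  refine ⟨b.map (LinearMap.linearEquivOfInjective D.toLinearMap hD ?_), fun i => ?_⟩
  · rw [Module.finrank_eq_card_basis b, hι, finrank_euclideanSpace_fin]
  · rw [Module.Basis.map_apply]
    rfl

namespace IsAdaptedChart

variable {T : 𝒳 → 𝒯} {W : 𝒳 → 𝒲}
  {Φ : OpenPartialHomeomorph
      (EuclideanSpace ℝ (Fin l) × EuclideanSpace ℝ (Fin m) × EuclideanSpace ℝ (Fin r)) 𝒳}
  {τ : OpenPartialHomeomorph (EuclideanSpace ℝ (Fin l)) 𝒯}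
  {σ : OpenPartialHomeomorph (EuclideanSpace ℝ (Fin m)) 𝒲}
  {p : EuclideanSpace ℝ (Fin l) × EuclideanSpace ℝ (Fin m) × EuclideanSpace ℝ (Fin r)}

theorem mdifferentiableAt (h : IsAdaptedChart (k := k) T W Φ τ σ) (hp : p ∈ Φ.source) :
    MDifferentiableAt 𝓘(ℝ, EuclideanSpace ℝ (Fin l) × EuclideanSpace ℝ (Fin m) ×
      EuclideanSpace ℝ (Fin r)) (𝓡 k) Φ p :=
  (h.smooth.contMDiffAt (Φ.open_source.mem_nhds hp)).mdifferentiableAt (by simp)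

/-- Differentiate the identity `T ∘ Φ = τ ∘ Prod.fst`, which holds near `p`. -/
theorem mfderiv_left (h : IsAdaptedChart (k := k) T W Φ τ σ) (hT : ContMDiff (𝓡 k) (𝓡 l) ∞ T)
    (hp : p ∈ Φ.source)
    (v : EuclideanSpace ℝ (Fin l) × EuclideanSpace ℝ (Fin m) × EuclideanSpace ℝ (Fin r)) :
    (mfderiv (𝓡 k) (𝓡 l) T (Φ p) (tangentMapCoord (n := k) Φ p v) : EuclideanSpace ℝ (Fin l))
      = tangentMapCoord (n := l) τ p.1 v.1 := by
  have hev : T ∘ Φ =ᶠ[𝓝 p] τ ∘ Prod.fst := by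
    filter_upwards [Φ.open_source.mem_nhds hp] with q hq using h.apply_left q hq
  have h1 := mfderiv_comp p (hT.mdifferentiable (by simp) (Φ p)) (h.mdifferentiableAt hp)
  have h2 := tangentMapCoord_comp (n := l) (Φ := τ) (u := p)
    ((h.smooth_left.contMDiffAt (τ.open_source.mem_nhds (h.fst_mem p hp))).mdifferentiableAt
      (by simp)) hasFDerivAt_fst
  exact ((DFunLike.congr_fun h1 v).symm.trans (DFunLike.congr_fun hev.mfderiv_eq v)).trans
    (DFunLike.congr_fun h2 v)

theorem mfderiv_right (h : IsAdaptedChart (k := k) T W Φ τ σ) (hW : ContMDiff (𝓡 k) (𝓡 m) ∞ W)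
    (hp : p ∈ Φ.source)
    (v : EuclideanSpace ℝ (Fin l) × EuclideanSpace ℝ (Fin m) × EuclideanSpace ℝ (Fin r)) :
    (mfderiv (𝓡 k) (𝓡 m) W (Φ p) (tangentMapCoord (n := k) Φ p v) : EuclideanSpace ℝ (Fin m))
      = tangentMapCoord (n := m) σ p.2.1 v.2.1 := by
  have hev : W ∘ Φ =ᶠ[𝓝 p] σ ∘ fun q => q.2.1 := by
    filter_upwards [Φ.open_source.mem_nhds hp] with q hq using h.apply_right q hq
  have h1 := mfderiv_comp p (hW.mdifferentiable (by simp) (Φ p)) (h.mdifferentiableAt hp)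
  have h2 := tangentMapCoord_comp (n := m) (Φ := σ) (ι := fun q :
      EuclideanSpace ℝ (Fin l) × EuclideanSpace ℝ (Fin m) × EuclideanSpace ℝ (Fin r) => q.2.1)
    (u := p)
    ((h.smooth_right.contMDiffAt (σ.open_source.mem_nhds (h.snd_mem p hp))).mdifferentiableAt
      (by simp)) (hasFDerivAt_fst.comp p hasFDerivAt_snd)
  exact ((DFunLike.congr_fun h1 v).symm.trans (DFunLike.congr_fun hev.mfderiv_eq v)).trans
    (DFunLike.congr_fun h2 v)

variable [RiemannianBundle (fun x : 𝒳 => TangentSpace (𝓡 k) x)]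
  [RiemannianBundle (fun x : 𝒲 => TangentSpace (𝓡 m) x)]
  [RiemannianBundle (fun x : 𝒯 => TangentSpace (𝓡 l) x)]

/-- The volume density of an adapted chart. -/
noncomputable def density (Φ : OpenPartialHomeomorph (EuclideanSpace ℝ (Fin l) ×
      EuclideanSpace ℝ (Fin m) × EuclideanSpace ℝ (Fin r)) 𝒳)
    (p : EuclideanSpace ℝ (Fin l) × EuclideanSpace ℝ (Fin m) × EuclideanSpace ℝ (Fin r)) : ℝ :=
  tangentVolume (Φ p) fun i => tangentMapCoord (n := k) Φ p (tripleBasis l m r i)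

/-- The volume density of an adapted chart restricted to a fibre of `W`. -/
noncomputable def fibreDensity (Φ : OpenPartialHomeomorph (EuclideanSpace ℝ (Fin l) ×
      EuclideanSpace ℝ (Fin m) × EuclideanSpace ℝ (Fin r)) 𝒳)
    (p : EuclideanSpace ℝ (Fin l) × EuclideanSpace ℝ (Fin m) × EuclideanSpace ℝ (Fin r)) : ℝ :=
  tangentVolume (Φ p) fun i : Fin (l + r) =>
    tangentMapCoord (n := k) Φ p (sliceMap l m r (EuclideanSpace.single i 1))

/-- The volume density of an adapted chart restricted to a fibre of `(T, W)`. -/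
noncomputable def jointFibreDensity (Φ : OpenPartialHomeomorph (EuclideanSpace ℝ (Fin l) ×
      EuclideanSpace ℝ (Fin m) × EuclideanSpace ℝ (Fin r)) 𝒳)
    (p : EuclideanSpace ℝ (Fin l) × EuclideanSpace ℝ (Fin m) × EuclideanSpace ℝ (Fin r)) : ℝ :=
  tangentVolume (Φ p) fun i : Fin r =>
    tangentMapCoord (n := k) Φ p (0, 0, EuclideanSpace.single i 1)

theorem volDensity_left_pos (h : IsAdaptedChart (k := k) T W Φ τ σ)
    {a : EuclideanSpace ℝ (Fin l)} (ha : a ∈ τ.source) : 0 < volDensity (n := l) τ a := by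
  obtain ⟨u, hu⟩ := exists_basis_of_injective (EuclideanSpace.basisFun (Fin l) ℝ).toBasis
    (Fintype.card_fin l) _ (h.injective_left a ha)
  have h1 := tangentVolume_pos (τ a) u.linearIndependent
  have h2 : (u : Fin l → _) = fun i => tangentMapCoord (n := l) τ a (EuclideanSpace.single i 1) :=
    funext fun i => by simp [hu]
  rwa [h2] at h1

theorem volDensity_right_pos (h : IsAdaptedChart (k := k) T W Φ τ σ)
    {b : EuclideanSpace ℝ (Fin m)} (hb : b ∈ σ.source) : 0 < volDensity (n := m) σ b := by
  obtain ⟨u, hu⟩ := exists_basis_of_injective (EuclideanSpace.basisFun (Fin m) ℝ).toBasis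
    (Fintype.card_fin m) _ (h.injective_right b hb)
  have h1 := tangentVolume_pos (σ b) u.linearIndependent
  have h2 : (u : Fin m → _) = fun i => tangentMapCoord (n := m) σ b (EuclideanSpace.single i 1) :=
    funext fun i => by simp [hu]
  rwa [h2] at h1

theorem sliceMap_single (i : Fin l ⊕ Fin r) :
    sliceMap l m r (EuclideanSpace.single (finSumFinEquiv i) 1)
      = tripleBasis l m r (Sum.elim Sum.inl (fun j => Sum.inr (Sum.inr j)) i) := by
  rcases i with i | i
  · rw [sliceMap_apply, finAddEquivProd_single_left, Sum.elim_inl, tripleBasis_inl]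
  · rw [sliceMap_apply, finAddEquivProd_single_right, Sum.elim_inr, tripleBasis_inr_inr]

theorem fibreDensity_pos (h : IsAdaptedChart (k := k) T W Φ τ σ) (hp : p ∈ Φ.source) :
    0 < fibreDensity (k := k) Φ p := by
  have hind : LinearIndependent ℝ
      (tripleBasis l m r ∘ (Sum.elim Sum.inl fun j => Sum.inr (Sum.inr j))) :=
    (tripleBasis l m r).linearIndependent.comp _ (by
      rintro (i | i) (j | j) <;> simp)
  have := hind.map' (tangentMapCoord (n := k) Φ p).toLinearMap
    (LinearMap.ker_eq_bot.2 (h.injective p hp))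
  have h1 := tangentVolume_pos (Φ p) this
  rw [fibreDensity, ← tangentVolume_comp_equiv _ _ finSumFinEquiv]
  simp only [sliceMap_single]
  exact h1

theorem jointFibreDensity_pos (h : IsAdaptedChart (k := k) T W Φ τ σ) (hp : p ∈ Φ.source) :
    0 < jointFibreDensity (k := k) Φ p := by
  have hind : LinearIndependent ℝ
      (tripleBasis l m r ∘ fun j => Sum.inr (Sum.inr j)) :=
    (tripleBasis l m r).linearIndependent.comp _ (by intro i j; simp)
  have := hind.map' (tangentMapCoord (n := k) Φ p).toLinearMap
    (LinearMap.ker_eq_bot.2 (h.injective p hp))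
  have h1 := tangentVolume_pos (Φ p) this
  rw [jointFibreDensity]
  simp only [← tripleBasis_inr_inr]
  exact h1

theorem density_pos (h : IsAdaptedChart (k := k) T W Φ τ σ)  (hp : p ∈ Φ.source) : 0 < density (k := k) Φ p := by
  have h1 := (tripleBasis l m r).linearIndependent.map' (tangentMapCoord (n := k) Φ p).toLinearMap
    (LinearMap.ker_eq_bot.2 (h.injective p hp))
  exact tangentVolume_pos (Φ p) h1

/-- The coordinate basis is reordered so that the `b`-directions come first: `dW` maps them to the
basis given by `σ`, while the `a`- and `z`-directions span its kernel. -/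
theorem jac_apply (h : IsAdaptedChart (k := k) T W Φ τ σ) (hk : k = l + m + r)
    (hW : ContMDiff (𝓡 k) (𝓡 m) ∞ W) (hp : p ∈ Φ.source) :
    jac (k := k) (m := m) W (Φ p) = ENNReal.ofReal (density (k := k) Φ p /
      (volDensity (n := m) σ p.2.1 * fibreDensity (k := k) Φ p)) := by
  let e : Fin m ⊕ (Fin l ⊕ Fin r) ≃ Fin l ⊕ Fin m ⊕ Fin r :=
    (Equiv.sumAssoc _ _ _).symm.trans (((Equiv.sumComm _ _).sumCongr (Equiv.refl _)).trans
      (Equiv.sumAssoc _ _ _))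
  obtain ⟨u, hu⟩ := exists_basis_of_injective ((tripleBasis l m r).reindex e.symm)
    (by simp [hk]; ring) _ (h.injective p hp)
  obtain ⟨v, hv⟩ := exists_basis_of_injective (EuclideanSpace.basisFun (Fin m) ℝ).toBasis
    (Fintype.card_fin m) _ (h.injective_right p.2.1 (h.snd_mem p hp))
  have hu' : ∀ i, u i = tangentMapCoord (n := k) Φ p (tripleBasis l m r (e i)) := by
    intro i
    rw [hu, Module.Basis.reindex_apply, Equiv.symm_symm]
  have e1 : ∀ i, e (Sum.inl i) = Sum.inr (Sum.inl i) := fun i => rfl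
  have e2 : ∀ i, e (Sum.inr i) = Sum.elim Sum.inl (fun j => Sum.inr (Sum.inr j)) i := by
    rintro (i | i) <;> rfl
  have hr : ∀ i : Fin l ⊕ Fin r, (tripleBasis l m r
      (Sum.elim Sum.inl (fun j => Sum.inr (Sum.inr j)) i)).2.1 = 0 := by
    rintro (i | i) <;> simp [tripleBasis_inl, tripleBasis_inr_inr]
  have f1 : tangentVolume (Φ p) u = density (k := k) Φ p := by
    rw [density, ← tangentVolume_comp_equiv _ _ e]
    exact congrArg _ (funext hu')
  have f2 : tangentVolume (W (Φ p)) v = volDensity (n := m) σ p.2.1 := by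
    rw [h.apply_right p hp, volDensity_eq_tangentVolume]
    exact congrArg _ (funext fun i => by simp [hv])
  have f3 : (tangentVolume (Φ p) fun j => u (Sum.inr j)) = fibreDensity (k := k) Φ p := by
    rw [fibreDensity, ← tangentVolume_comp_equiv _ _ finSumFinEquiv]
    exact congrArg _ (funext fun i => by rw [hu', sliceMap_single, e2])
  rw [jac_eq_tangentVolume W (Φ p) u v, f1, f2, f3]
  · intro i
    rw [hu', e1, tripleBasis_inr_inl]
    exact (h.mfderiv_right hW hp _).trans (by rw [hv]; simp; rfl)
  · intro i
    rw [hu', e2]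
    refine (h.mfderiv_right hW hp _).trans ?_
    rw [hr, map_zero]
    rfl

theorem jacPair_apply (h : IsAdaptedChart (k := k) T W Φ τ σ) (hk : k = l + m + r)
    (hT : ContMDiff (𝓡 k) (𝓡 l) ∞ T) (hW : ContMDiff (𝓡 k) (𝓡 m) ∞ W) (hp : p ∈ Φ.source) :
    jacPair (k := k) (l := l) (m := m) T W (Φ p) = ENNReal.ofReal (density (k := k) Φ p /
      (volDensity (n := l) τ p.1 * volDensity (n := m) σ p.2.1
        * jointFibreDensity (k := k) Φ p)) := by
  obtain ⟨u, hu⟩ := exists_basis_of_injective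
    ((tripleBasis l m r).reindex (Equiv.sumAssoc _ _ _).symm)
    (by simp [hk]) _ (h.injective p hp)
  obtain ⟨t, ht⟩ := exists_basis_of_injective (EuclideanSpace.basisFun (Fin l) ℝ).toBasis
    (Fintype.card_fin l) _ (h.injective_left p.1 (h.fst_mem p hp))
  obtain ⟨v, hv⟩ := exists_basis_of_injective (EuclideanSpace.basisFun (Fin m) ℝ).toBasis
    (Fintype.card_fin m) _ (h.injective_right p.2.1 (h.snd_mem p hp))
  have hu' : ∀ i, u i = tangentMapCoord (n := k) Φ p
      (tripleBasis l m r (Equiv.sumAssoc _ _ _ i)) := by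
    intro i
    rw [hu, Module.Basis.reindex_apply, Equiv.symm_symm]
  have u1 : ∀ i, u (Sum.inl (Sum.inl i))
      = tangentMapCoord (n := k) Φ p (EuclideanSpace.single i 1, 0, 0) := fun i => by
    rw [hu', Equiv.sumAssoc_apply_inl_inl, tripleBasis_inl]
  have u2 : ∀ i, u (Sum.inl (Sum.inr i))
      = tangentMapCoord (n := k) Φ p (0, EuclideanSpace.single i 1, 0) := fun i => by
    rw [hu', Equiv.sumAssoc_apply_inl_inr, tripleBasis_inr_inl]
  have u3 : ∀ i, u (Sum.inr i)
      = tangentMapCoord (n := k) Φ p (0, 0, EuclideanSpace.single i 1) := fun i => by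
    rw [hu', Equiv.sumAssoc_apply_inr, tripleBasis_inr_inr]
  have f1 : tangentVolume (Φ p) u = density (k := k) Φ p := by
    rw [density, ← tangentVolume_comp_equiv _ _ (Equiv.sumAssoc _ _ _)]
    exact congrArg _ (funext hu')
  have f2 : tangentVolume (W (Φ p)) v = volDensity (n := m) σ p.2.1 := by
    rw [h.apply_right p hp, volDensity_eq_tangentVolume]
    exact congrArg _ (funext fun i => by simp [hv])
  have f3 : (tangentVolume (Φ p) fun j => u (Sum.inr j)) = jointFibreDensity (k := k) Φ p := by
    rw [jointFibreDensity]
    exact congrArg _ (funext u3)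
  have f4 : tangentVolume (T (Φ p)) t = volDensity (n := l) τ p.1 := by
    rw [h.apply_left p hp, volDensity_eq_tangentVolume]
    exact congrArg _ (funext fun i => by simp [ht])
  rw [jacPair_eq_tangentVolume T W (Φ p) u t v, f1, f2, f3, f4]
  · intro i
    rw [u1]
    exact (h.mfderiv_left hT hp _).trans (by rw [ht]; simp; rfl)
  · intro i
    rw [u2]
    exact (h.mfderiv_left hT hp _).trans (map_zero _)
  · intro i
    rw [u3]
    exact (h.mfderiv_left hT hp _).trans (map_zero _)
  · intro i
    rw [u1]
    exact (h.mfderiv_right hW hp _).trans (map_zero _)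
  · intro i
    rw [u2]
    exact (h.mfderiv_right hW hp _).trans (by rw [hv]; simp; rfl)
  · intro i
    rw [u3]
    exact (h.mfderiv_right hW hp _).trans (map_zero _)

/-- The multiplicativity of the Jacobian factors along `W⁻¹{w} ⊇ T⁻¹{t} ∩ W⁻¹{w}`. -/
theorem jac_mul_fibreDensity (h : IsAdaptedChart (k := k) T W Φ τ σ) (hk : k = l + m + r)
    (hT : ContMDiff (𝓡 k) (𝓡 l) ∞ T) (hW : ContMDiff (𝓡 k) (𝓡 m) ∞ W) (hp : p ∈ Φ.source) :
    jac (k := k) (m := m) W (Φ p) * ENNReal.ofReal (fibreDensity (k := k) Φ p)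
      = jacPair (k := k) (l := l) (m := m) T W (Φ p)
        * ENNReal.ofReal (jointFibreDensity (k := k) Φ p)
        * ENNReal.ofReal (volDensity (n := l) τ p.1) := by
  have h1 := h.fibreDensity_pos hp
  have h2 := h.jointFibreDensity_pos hp
  have h3 := h.volDensity_left_pos (h.fst_mem p hp)
  have h4 := h.volDensity_right_pos (h.snd_mem p hp)
  rw [h.jac_apply hk hW hp, h.jacPair_apply hk hT hW hp, ← ENNReal.ofReal_mul' h1.le,
    ← ENNReal.ofReal_mul' h2.le, ← ENNReal.ofReal_mul' h3.le]
  congr 1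
  field_simp

variable [IsManifold (𝓡 k) ∞ 𝒳] [IsManifold (𝓡 m) ∞ 𝒲] [IsManifold (𝓡 l) ∞ 𝒯]
  [IsContMDiffRiemannianBundle (𝓡 k) ∞ (EuclideanSpace ℝ (Fin k))
      (fun x : 𝒳 => TangentSpace (𝓡 k) x)]
  [IsContMDiffRiemannianBundle (𝓡 m) ∞ (EuclideanSpace ℝ (Fin m))
      (fun x : 𝒲 => TangentSpace (𝓡 m) x)]
  [IsContMDiffRiemannianBundle (𝓡 l) ∞ (EuclideanSpace ℝ (Fin l))
      (fun x : 𝒯 => TangentSpace (𝓡 l) x)]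

theorem continuousOn_density (h : IsAdaptedChart (k := k) T W Φ τ σ) :
    ContinuousOn (density (k := k) Φ) Φ.source :=
  h.smooth.continuousOn_tangentVolume Φ.open_source _

theorem continuousOn_fibreDensity (h : IsAdaptedChart (k := k) T W Φ τ σ) :
    ContinuousOn (fibreDensity (k := k) Φ) Φ.source :=
  h.smooth.continuousOn_tangentVolume Φ.open_source _

theorem continuousOn_jointFibreDensity (h : IsAdaptedChart (k := k) T W Φ τ σ) :
    ContinuousOn (jointFibreDensity (k := k) Φ) Φ.source :=
  h.smooth.continuousOn_tangentVolume Φ.open_source _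

theorem continuousOn_volDensity_left (h : IsAdaptedChart (k := k) T W Φ τ σ) :
    ContinuousOn (volDensity (n := l) τ) τ.source :=
  h.smooth_left.continuousOn_tangentVolume τ.open_source _

theorem continuousOn_volDensity_right (h : IsAdaptedChart (k := k) T W Φ τ σ) :
    ContinuousOn (volDensity (n := m) σ) σ.source :=
  h.smooth_right.continuousOn_tangentVolume σ.open_source _

/-- In the chart the factor is a quotient of continuous, strictly positive volume densities. -/
theorem continuousOn_jac (h : IsAdaptedChart (k := k) T W Φ τ σ) (hk : k = l + m + r)
    (hW : ContMDiff (𝓡 k) (𝓡 m) ∞ W) :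
    ContinuousOn (jac (k := k) (m := m) W) Φ.target := by
  have h1 : ContinuousOn (fun p => ENNReal.ofReal (density (k := k) Φ p /
      (volDensity (n := m) σ p.2.1 * fibreDensity (k := k) Φ p))) Φ.source := by
    refine ENNReal.continuous_ofReal.comp_continuousOn (h.continuousOn_density.div
      ((h.continuousOn_volDensity_right.comp
        (continuous_fst.comp continuous_snd).continuousOn h.snd_mem).mul
        h.continuousOn_fibreDensity) fun p hp => ?_)
    exact (mul_pos (h.volDensity_right_pos (h.snd_mem p hp)) (h.fibreDensity_pos hp)).ne'
  refine (h1.comp Φ.continuousOn_symm fun x hx => Φ.map_target hx).congr fun x hx => ?_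
  have := h.jac_apply hk hW (Φ.map_target hx)
  rwa [Φ.right_inv hx] at this

theorem continuousOn_jacPair (h : IsAdaptedChart (k := k) T W Φ τ σ) (hk : k = l + m + r)
    (hT : ContMDiff (𝓡 k) (𝓡 l) ∞ T) (hW : ContMDiff (𝓡 k) (𝓡 m) ∞ W) :
    ContinuousOn (jacPair (k := k) (l := l) (m := m) T W) Φ.target := by
  have h1 : ContinuousOn (fun p => ENNReal.ofReal (density (k := k) Φ p /
      (volDensity (n := l) τ p.1 * volDensity (n := m) σ p.2.1
        * jointFibreDensity (k := k) Φ p))) Φ.source := by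
    refine ENNReal.continuous_ofReal.comp_continuousOn (h.continuousOn_density.div
      (((h.continuousOn_volDensity_left.comp continuous_fst.continuousOn h.fst_mem).mul
        (h.continuousOn_volDensity_right.comp
        (continuous_fst.comp continuous_snd).continuousOn h.snd_mem)).mul
        h.continuousOn_jointFibreDensity) fun p hp => ?_)
    exact (mul_pos (mul_pos (h.volDensity_left_pos (h.fst_mem p hp))
      (h.volDensity_right_pos (h.snd_mem p hp))) (h.jointFibreDensity_pos hp)).ne'
  refine (h1.comp Φ.continuousOn_symm fun x hx => Φ.map_target hx).congr fun x hx => ?_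
  have := h.jacPair_apply hk hT hW (Φ.map_target hx)
  rwa [Φ.right_inv hx] at this

end IsAdaptedChart

end AdaptedJacobian

/-! ### The coarea formula in an adapted chart -/

section LocalCoarea

open Set Filter Topology

set_option linter.unusedSectionVars false

theorem measurable_indicator_of_domRestrict {X Y : Type*} [MeasurableSpace X] [MeasurableSpace Y]
    [Zero Y] {O : Set X} (hO : MeasurableSet O) {f : X → Y} (hf : Measurable (O.domRestrict f)) :
    Measurable (O.indicator f) := by
  refine measurable_of_restrict_of_restrict_compl hO ?_ ?_
  · convert hf using 1
    ext x
    simp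
  · convert measurable_const (a := (0 : Y)) using 1
    ext x
    simp [indicator_of_notMem x.2]

theorem measurable_indicator_mul_comp {X Y : Type*} [TopologicalSpace X] [MeasurableSpace X]
    [BorelSpace X] [TopologicalSpace Y] [MeasurableSpace Y] [BorelSpace Y] {O : Set X}
    (hO : IsOpen O) {c : X → ℝ≥0∞} (hc : ContinuousOn c O) {φ : X → Y} (hφ : ContinuousOn φ O)
    {g : Y → ℝ≥0∞} (hg : Measurable g) : Measurable (O.indicator fun x => c x * g (φ x)) :=
  measurable_indicator_of_domRestrict hO.measurableSet
    ((continuousOn_iff_continuous_domRestrict.1 hc).measurable.mul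
      (hg.comp (continuousOn_iff_continuous_domRestrict.1 hφ).measurable))

section Support

variable {n d : ℕ} {M : Type*} [TopologicalSpace M] [ChartedSpace (EuclideanSpace ℝ (Fin n)) M]
  [RiemannianBundle (fun x : M => TangentSpace (𝓡 n) x)] [MeasurableSpace M] [BorelSpace M]

theorem lintegral_volumeOn_congr {S : Set M} (hS : MeasurableSet S) {g g' : M → ℝ≥0∞}
    (h : ∀ x ∈ S, g x = g' x) :
    ∫⁻ x, g x ∂(volumeOn (n := n) d S) = ∫⁻ x, g' x ∂(volumeOn (n := n) d S) := by
  refine lintegral_congr_ae ?_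
  have h0 : ∀ᵐ x ∂(volumeOn (n := n) d S), x ∈ S := volumeOn_compl_eq_zero hS
  filter_upwards [h0] with x hx using h x hx

theorem lintegral_volumeOn_eq_zero {S : Set M} (hS : MeasurableSet S) {g : M → ℝ≥0∞}
    (h : ∀ x ∈ S, g x = 0) : ∫⁻ x, g x ∂(volumeOn (n := n) d S) = 0 := by
  rw [lintegral_volumeOn_congr hS h, lintegral_zero]

end Support

variable {k l m r : ℕ}
  {𝒳 : Type*} [TopologicalSpace 𝒳] [ChartedSpace (EuclideanSpace ℝ (Fin k)) 𝒳]
  {𝒲 : Type*} [TopologicalSpace 𝒲] [ChartedSpace (EuclideanSpace ℝ (Fin m)) 𝒲]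
  {𝒯 : Type*} [TopologicalSpace 𝒯] [ChartedSpace (EuclideanSpace ℝ (Fin l)) 𝒯]

/-- The affine map `(a, z) ↦ (a, b, z)`. -/
noncomputable def sliceEmb (b : EuclideanSpace ℝ (Fin m)) (u : EuclideanSpace ℝ (Fin (l + r))) :
    EuclideanSpace ℝ (Fin l) × EuclideanSpace ℝ (Fin m) × EuclideanSpace ℝ (Fin r) :=
  ((EuclideanSpace.finAddEquivProd u).1, b, (EuclideanSpace.finAddEquivProd u).2)

theorem sliceEmb_eq_add (b : EuclideanSpace ℝ (Fin m)) :
    sliceEmb (l := l) (r := r) b = fun u => (0, b, 0) + sliceMap l m r u := by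
  ext1 u
  rw [sliceMap_apply, sliceEmb]
  simp

theorem mem_range_sliceEmb {b : EuclideanSpace ℝ (Fin m)}
    {p : EuclideanSpace ℝ (Fin l) × EuclideanSpace ℝ (Fin m) × EuclideanSpace ℝ (Fin r)} :
    p ∈ range (sliceEmb (l := l) (r := r) b) ↔ p.2.1 = b := by
  constructor
  · rintro ⟨u, rfl⟩
    rfl
  · rintro rfl
    refine ⟨EuclideanSpace.finAddEquivProd.symm (p.1, p.2.2), ?_⟩
    simp only [sliceEmb, ContinuousLinearEquiv.apply_symm_apply]

theorem contDiff_sliceEmb (b : EuclideanSpace ℝ (Fin m)) :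
    ContDiff ℝ ∞ (sliceEmb (l := l) (r := r) b) := by
  rw [sliceEmb_eq_add]
  exact contDiff_const.add (sliceMap l m r).contDiff

theorem hasFDerivAt_sliceEmb (b : EuclideanSpace ℝ (Fin m)) (u : EuclideanSpace ℝ (Fin (l + r))) :
    HasFDerivAt (sliceEmb (l := l) (r := r) b) (sliceMap l m r) u := by
  rw [sliceEmb_eq_add]
  exact (sliceMap l m r).hasFDerivAt.const_add _

theorem injective_sliceMap : Function.Injective (sliceMap l m r) := by
  intro u v huv
  rw [sliceMap_apply, sliceMap_apply, Prod.mk.injEq, Prod.mk.injEq] at huv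
  exact EuclideanSpace.finAddEquivProd.injective (Prod.ext huv.1 huv.2.2)

theorem isEmbedding_sliceEmb (b : EuclideanSpace ℝ (Fin m)) :
    IsEmbedding (sliceEmb (l := l) (r := r) b) :=
  Function.LeftInverse.isEmbedding
    (f := fun p => EuclideanSpace.finAddEquivProd.symm (p.1, p.2.2))
    (fun u => by simp only [sliceEmb]; exact EuclideanSpace.finAddEquivProd.symm_apply_apply u)
    (EuclideanSpace.finAddEquivProd.symm.continuous.comp
      (continuous_fst.prodMk (continuous_snd.comp continuous_snd)))
    (contDiff_sliceEmb b).continuous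

namespace IsAdaptedChart

variable {T : 𝒳 → 𝒯} {W : 𝒳 → 𝒲}
  {Φ : OpenPartialHomeomorph
      (EuclideanSpace ℝ (Fin l) × EuclideanSpace ℝ (Fin m) × EuclideanSpace ℝ (Fin r)) 𝒳}
  {τ : OpenPartialHomeomorph (EuclideanSpace ℝ (Fin l)) 𝒯}
  {σ : OpenPartialHomeomorph (EuclideanSpace ℝ (Fin m)) 𝒲}
  {a : EuclideanSpace ℝ (Fin l)} {b : EuclideanSpace ℝ (Fin m)}

theorem mem_fibre_iff (h : IsAdaptedChart (k := k) T W Φ τ σ) (hb : b ∈ σ.source)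
    {p : EuclideanSpace ℝ (Fin l) × EuclideanSpace ℝ (Fin m) × EuclideanSpace ℝ (Fin r)}
    (hp : p ∈ Φ.source) : W (Φ p) = σ b ↔ p.2.1 = b := by
  rw [h.apply_right p hp]
  exact σ.injOn.eq_iff (h.snd_mem p hp) hb

theorem mem_fibre_left_iff (h : IsAdaptedChart (k := k) T W Φ τ σ) (ha : a ∈ τ.source)
    {p : EuclideanSpace ℝ (Fin l) × EuclideanSpace ℝ (Fin m) × EuclideanSpace ℝ (Fin r)}
    (hp : p ∈ Φ.source) : T (Φ p) = τ a ↔ p.1 = a := by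
  rw [h.apply_left p hp]
  exact τ.injOn.eq_iff (h.fst_mem p hp) ha

theorem isLocalParam_fibre (h : IsAdaptedChart (k := k) T W Φ τ σ) (hb : b ∈ σ.source) :
    IsLocalParam (n := k) (W ⁻¹' {σ b}) (sliceEmb b ⁻¹' Φ.source) (Φ ∘ sliceEmb b) :=
  Φ.isLocalParam_slice h.smooth h.injective (contDiff_sliceEmb b) (hasFDerivAt_sliceEmb b)
    injective_sliceMap (isEmbedding_sliceEmb b) fun p hp => by
      rw [mem_range_sliceEmb]
      exact h.mem_fibre_iff hb hp

theorem isLocalParam_jointFibre (h : IsAdaptedChart (k := k) T W Φ τ σ) (ha : a ∈ τ.source)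
    (hb : b ∈ σ.source) :
    IsLocalParam (n := k) (T ⁻¹' {τ a} ∩ W ⁻¹' {σ b}) ((fun z => (a, b, z)) ⁻¹' Φ.source)
      (Φ ∘ fun z => (a, b, z)) := by
  refine Φ.isLocalParam_slice h.smooth h.injective
    (contDiff_const.prodMk (contDiff_const.prodMk contDiff_id))
    (L := (0 : _ →L[ℝ] _).prod ((0 : _ →L[ℝ] _).prod (ContinuousLinearMap.id ℝ _)))
    (fun u => (hasFDerivAt_const _ _).prodMk ((hasFDerivAt_const _ _).prodMk (hasFDerivAt_id _)))
    (fun z z' hz => congrArg (fun p : EuclideanSpace ℝ (Fin l) × EuclideanSpace ℝ (Fin m) ×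
      EuclideanSpace ℝ (Fin r) => p.2.2) hz)
    (Function.LeftInverse.isEmbedding (f := fun p => p.2.2) (fun z => rfl)
      (continuous_snd.comp continuous_snd) (by fun_prop)) fun p hp => ?_
  refine (and_congr (h.mem_fibre_left_iff ha hp) (h.mem_fibre_iff hb hp)).trans ?_
  constructor
  · rintro ⟨rfl, rfl⟩
    exact ⟨p.2.2, rfl⟩
  · rintro ⟨z, rfl⟩
    exact ⟨rfl, rfl⟩

theorem isLocalParam_left (h : IsAdaptedChart (k := k) T W Φ τ σ) :
    IsLocalParam (n := l) univ τ.source τ where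
  isOpen := τ.open_source
  smooth := h.smooth_left
  injOn := τ.injOn
  immersion := h.injective_left
  mapsTo _ _ := mem_univ _
  isOpen_image V hV hVo :=
    ⟨τ '' V, τ.isOpen_image_of_subset_source hVo hV, (inter_univ _).symm⟩

variable [RiemannianBundle (fun x : 𝒳 => TangentSpace (𝓡 k) x)]
  [RiemannianBundle (fun x : 𝒲 => TangentSpace (𝓡 m) x)]
  [RiemannianBundle (fun x : 𝒯 => TangentSpace (𝓡 l) x)]

theorem volDensity_fibre (h : IsAdaptedChart (k := k) T W Φ τ σ)
    {u : EuclideanSpace ℝ (Fin (l + r))} (hu : sliceEmb b u ∈ Φ.source) :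
    volDensity (n := k) (Φ ∘ sliceEmb b) u = fibreDensity (k := k) Φ (sliceEmb b u) := by
  rw [volDensity_eq_tangentVolume,
    tangentMapCoord_comp (h.mdifferentiableAt hu) (hasFDerivAt_sliceEmb b u)]
  rfl

theorem volDensity_jointFibre (h : IsAdaptedChart (k := k) T W Φ τ σ)
    {z : EuclideanSpace ℝ (Fin r)} (hz : (a, b, z) ∈ Φ.source) :
    volDensity (n := k) (Φ ∘ fun z => (a, b, z)) z
      = jointFibreDensity (k := k) Φ (a, b, z) := by
  rw [volDensity_eq_tangentVolume, tangentMapCoord_comp (ι := fun z => (a, b, z))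
    (L := (0 : _ →L[ℝ] _).prod ((0 : _ →L[ℝ] _).prod (ContinuousLinearMap.id ℝ _)))
    (h.mdifferentiableAt hz)
    ((hasFDerivAt_const _ _).prodMk ((hasFDerivAt_const _ _).prodMk (hasFDerivAt_id _)))]
  rfl

variable [IsManifold (𝓡 k) ∞ 𝒳] [IsManifold (𝓡 m) ∞ 𝒲] [IsManifold (𝓡 l) ∞ 𝒯]
  [IsContMDiffRiemannianBundle (𝓡 k) ∞ (EuclideanSpace ℝ (Fin k))
      (fun x : 𝒳 => TangentSpace (𝓡 k) x)]
  [IsContMDiffRiemannianBundle (𝓡 m) ∞ (EuclideanSpace ℝ (Fin m))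
      (fun x : 𝒲 => TangentSpace (𝓡 m) x)]
  [IsContMDiffRiemannianBundle (𝓡 l) ∞ (EuclideanSpace ℝ (Fin l))
      (fun x : 𝒯 => TangentSpace (𝓡 l) x)]
  [MeasurableSpace 𝒳] [BorelSpace 𝒳]

/-- The integrand over the fibres of `W` in an adapted chart. -/
noncomputable def fibreIntegrand (Φ : OpenPartialHomeomorph (EuclideanSpace ℝ (Fin l) ×
      EuclideanSpace ℝ (Fin m) × EuclideanSpace ℝ (Fin r)) 𝒳) (g : 𝒳 → ℝ≥0∞) :
    EuclideanSpace ℝ (Fin l) × EuclideanSpace ℝ (Fin m) × EuclideanSpace ℝ (Fin r) → ℝ≥0∞ :=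
  Φ.source.indicator fun p => ENNReal.ofReal (fibreDensity (k := k) Φ p) * g (Φ p)

/-- The integrand over the fibres of `(T, W)` in an adapted chart. -/
noncomputable def jointFibreIntegrand (Φ : OpenPartialHomeomorph (EuclideanSpace ℝ (Fin l) ×
      EuclideanSpace ℝ (Fin m) × EuclideanSpace ℝ (Fin r)) 𝒳) (g : 𝒳 → ℝ≥0∞) :
    EuclideanSpace ℝ (Fin l) × EuclideanSpace ℝ (Fin m) × EuclideanSpace ℝ (Fin r) → ℝ≥0∞ :=
  Φ.source.indicator fun p => ENNReal.ofReal (jointFibreDensity (k := k) Φ p) * g (Φ p)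

theorem measurable_fibreIntegrand (h : IsAdaptedChart (k := k) T W Φ τ σ) {g : 𝒳 → ℝ≥0∞}
    (hg : Measurable g) : Measurable (fibreIntegrand (k := k) Φ g) :=
  measurable_indicator_mul_comp Φ.open_source
    (ENNReal.continuous_ofReal.comp_continuousOn h.continuousOn_fibreDensity)
    Φ.continuousOn hg

theorem measurable_jointFibreIntegrand (h : IsAdaptedChart (k := k) T W Φ τ σ) {g : 𝒳 → ℝ≥0∞}
    (hg : Measurable g) : Measurable (jointFibreIntegrand (k := k) Φ g) :=
  measurable_indicator_mul_comp Φ.open_source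
    (ENNReal.continuous_ofReal.comp_continuousOn h.continuousOn_jointFibreDensity)
    Φ.continuousOn hg

/-- The parameter space `ℝ^(l+r)` of the slice is split into `a` and `z`. Extending the integrand by
zero off the chart domain removes the moving domains of integration, so Tonelli applies on the full
product. -/
theorem lintegral_fibre (h : IsAdaptedChart (k := k) T W Φ τ σ) (hb : b ∈ σ.source)
    {g : 𝒳 → ℝ≥0∞} (hg : Measurable g) (hgΦ : ∀ x, g x ≠ 0 → x ∈ Φ.target) :
    ∫⁻ x, g x ∂(volumeOn (n := k) (l + r) (W ⁻¹' {σ b}))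
      = ∫⁻ a, ∫⁻ z, fibreIntegrand (k := k) Φ g (a, b, z) := by
  have hU : IsOpen (sliceEmb (l := l) (r := r) b ⁻¹' Φ.source) :=
    Φ.open_source.preimage (contDiff_sliceEmb b).continuous
  have hm := h.measurable_fibreIntegrand hg
  rw [(h.isLocalParam_fibre hb).lintegral_volumeOn Φ.open_target.measurableSet ?_ ?_ hg hgΦ]
  · calc _ = ∫⁻ u in sliceEmb (l := l) (r := r) b ⁻¹' Φ.source,
          fibreIntegrand (k := k) Φ g (sliceEmb b u) := by
          refine setLIntegral_congr_fun hU.measurableSet fun u (hu : sliceEmb b u ∈ Φ.source) => ?_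
          rw [fibreIntegrand, indicator_of_mem hu, h.volDensity_fibre hu]
          rfl
      _ = ∫⁻ u, fibreIntegrand (k := k) Φ g (sliceEmb b u) := by
          refine setLIntegral_eq_of_support_subset fun u hu => ?_
          by_contra (hu' : sliceEmb b u ∉ Φ.source)
          exact hu (indicator_of_notMem hu' _)
      _ = ∫⁻ q : EuclideanSpace ℝ (Fin l) × EuclideanSpace ℝ (Fin r),
          fibreIntegrand (k := k) Φ g (q.1, b, q.2) :=
          (EuclideanSpace.volume_preserving_finAddEquivProd (l := l) (r := r)).lintegral_comp
            (f := fun q => fibreIntegrand (k := k) Φ g (q.1, b, q.2))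
            (hm.comp (by fun_prop))
      _ = _ := by
          rw [Measure.volume_eq_prod, lintegral_prod]
          exact (hm.comp (by fun_prop)).aemeasurable
  · rintro x ⟨hx, hxS⟩
    have hp := Φ.map_target hx
    have hxS' : W x = σ b := hxS
    rw [← Φ.right_inv hx, h.mem_fibre_iff hb hp, ← mem_range_sliceEmb] at hxS'
    obtain ⟨u, hu⟩ := hxS'
    refine ⟨u, ?_, ?_⟩
    · rwa [mem_preimage, hu]
    · rw [Function.comp_apply, hu, Φ.right_inv hx]
  · exact (h.continuousOn_fibreDensity.comp (contDiff_sliceEmb b).continuous.continuousOn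
      fun u hu => hu).congr fun u hu => h.volDensity_fibre hu

theorem lintegral_jointFibre (h : IsAdaptedChart (k := k) T W Φ τ σ) (ha : a ∈ τ.source)
    (hb : b ∈ σ.source) {g : 𝒳 → ℝ≥0∞} (hg : Measurable g)
    (hgΦ : ∀ x, g x ≠ 0 → x ∈ Φ.target) :
    ∫⁻ x, g x ∂(volumeOn (n := k) r (T ⁻¹' {τ a} ∩ W ⁻¹' {σ b}))
      = ∫⁻ z, jointFibreIntegrand (k := k) Φ g (a, b, z) := by
  have hc : Continuous fun z : EuclideanSpace ℝ (Fin r) => (a, b, z) := by fun_prop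
  have hU : IsOpen ((fun z : EuclideanSpace ℝ (Fin r) => (a, b, z)) ⁻¹' Φ.source) :=
    Φ.open_source.preimage hc
  rw [(h.isLocalParam_jointFibre ha hb).lintegral_volumeOn Φ.open_target.measurableSet ?_ ?_
    hg hgΦ]
  · calc _ = ∫⁻ z in (fun z : EuclideanSpace ℝ (Fin r) => (a, b, z)) ⁻¹' Φ.source,
          jointFibreIntegrand (k := k) Φ g (a, b, z) := by
          refine setLIntegral_congr_fun hU.measurableSet fun z (hz : (a, b, z) ∈ Φ.source) => ?_
          rw [jointFibreIntegrand, indicator_of_mem hz, h.volDensity_jointFibre hz]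
          rfl
      _ = _ := by
          refine setLIntegral_eq_of_support_subset fun z hz => ?_
          by_contra (hz' : (a, b, z) ∉ Φ.source)
          exact hz (indicator_of_notMem hz' _)
  · rintro x ⟨hx, hxT, hxS⟩
    have hp := Φ.map_target hx
    have hxS' : W x = σ b := hxS
    have hxT' : T x = τ a := hxT
    rw [← Φ.right_inv hx, h.mem_fibre_iff hb hp] at hxS'
    rw [← Φ.right_inv hx, h.mem_fibre_left_iff ha hp] at hxT'
    have hu : (a, b, (Φ.symm x).2.2) = Φ.symm x := by rw [← hxS', ← hxT']
    refine ⟨(Φ.symm x).2.2, ?_, ?_⟩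
    · rwa [mem_preimage, hu]
    · rw [Function.comp_apply, hu, Φ.right_inv hx]
  · exact (h.continuousOn_jointFibreDensity.comp hc.continuousOn
      fun u hu => hu).congr fun u hu => h.volDensity_jointFibre hu

variable [T2Space 𝒲] [T2Space 𝒯] [MeasurableSpace 𝒯] [BorelSpace 𝒯]

/-- On the support of `g`, which lies in the chart, `T` only takes values in `τ.target`; for other
`t` the fibre misses the support. -/
theorem lintegral_jointFibre_eq_indicator (h : IsAdaptedChart (k := k) T W Φ τ σ)
    (hT : Continuous T) (hW : Continuous W)
    (hb : b ∈ σ.source) {g : 𝒳 → ℝ≥0∞} (hg : Measurable g)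
    (hgΦ : ∀ x, g x ≠ 0 → x ∈ Φ.target) (t : 𝒯) :
    ∫⁻ x, g x ∂(volumeOn (n := k) r (T ⁻¹' {t} ∩ W ⁻¹' {σ b}))
      = τ.target.indicator
          (fun t => ∫⁻ z, jointFibreIntegrand (k := k) Φ g (τ.symm t, b, z)) t := by
  by_cases ht : t ∈ τ.target
  · rw [indicator_of_mem ht, ← h.lintegral_jointFibre (τ.map_target ht) hb hg hgΦ, τ.right_inv ht]
  · rw [indicator_of_notMem ht]
    refine lintegral_volumeOn_eq_zero ((isClosed_singleton.preimage hT).inter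
      (isClosed_singleton.preimage hW)).measurableSet fun x hx => ?_
    by_contra hx0
    have hxt : T x = t := hx.1
    refine ht ?_
    rw [← hxt, ← Φ.right_inv (hgΦ x hx0), h.apply_left _ (Φ.map_target (hgΦ x hx0))]
    exact τ.map_source (h.fst_mem _ (Φ.map_target (hgΦ x hx0)))

theorem eq_zero_of_notMem_target (h : IsAdaptedChart (k := k) T W Φ τ σ) {w : 𝒲}
    (hw : w ∉ σ.target) {g : 𝒳 → ℝ≥0∞} (hgΦ : ∀ x, g x ≠ 0 → x ∈ Φ.target) {x : 𝒳}
    (hx : W x = w) : g x = 0 := by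
  by_contra hx0
  refine hw ?_
  rw [← hx, ← Φ.right_inv (hgΦ x hx0), h.apply_right _ (Φ.map_target (hgΦ x hx0))]
  exact σ.map_source (h.snd_mem _ (Φ.map_target (hgΦ x hx0)))

theorem measurable_lintegral_jointFibre (h : IsAdaptedChart (k := k) T W Φ τ σ)
    (hT : Continuous T) (hW : Continuous W) {g : 𝒳 → ℝ≥0∞} (hg : Measurable g)
    (hgΦ : ∀ x, g x ≠ 0 → x ∈ Φ.target) (w : 𝒲) :
    Measurable fun t => ∫⁻ x, g x ∂(volumeOn (n := k) r (T ⁻¹' {t} ∩ W ⁻¹' {w})) := by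
  by_cases hw : w ∈ σ.target
  · rw [← σ.right_inv hw]
    have hm : Measurable fun a => ∫⁻ z, jointFibreIntegrand (k := k) Φ g (a, σ.symm w, z) :=
      Measurable.lintegral_prod_right'
        (f := fun q : EuclideanSpace ℝ (Fin l) × EuclideanSpace ℝ (Fin r) =>
          jointFibreIntegrand (k := k) Φ g (q.1, σ.symm w, q.2))
        ((h.measurable_jointFibreIntegrand hg).comp (by fun_prop))
    rw [funext (h.lintegral_jointFibre_eq_indicator hT hW (σ.map_target hw) hg hgΦ)]
    exact measurable_indicator_of_domRestrict τ.open_target.measurableSet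
      (hm.comp (continuousOn_iff_continuous_domRestrict.1 τ.continuousOn_symm).measurable)
  · convert measurable_const (a := (0 : ℝ≥0∞)) using 2 with t
    exact lintegral_volumeOn_eq_zero ((isClosed_singleton.preimage hT).inter
      (isClosed_singleton.preimage hW)).measurableSet
      fun x hx => h.eq_zero_of_notMem_target hw hgΦ hx.2

/-- Both sides are iterated integrals over `a` and `z` at fixed `b`. The volume density of `τ` from
integration over `𝒯` supplies the factor that makes the integrands equal by `jac_mul_fibreDensity`.
-/
theorem coarea (h : IsAdaptedChart (k := k) T W Φ τ σ) (hk : k = l + m + r)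
    (hT : ContMDiff (𝓡 k) (𝓡 l) ∞ T) (hW : ContMDiff (𝓡 k) (𝓡 m) ∞ W)
    {g : 𝒳 → ℝ≥0∞} (hgΦ : ∀ x, g x ≠ 0 → x ∈ Φ.target)
    (hg₁ : Measurable fun x => g x * jac (k := k) (m := m) W x)
    (hg₂ : Measurable fun x => g x * jacPair (k := k) (l := l) (m := m) T W x) (w : 𝒲) :
    ∫⁻ x, g x * jac (k := k) (m := m) W x ∂(volumeOn (n := k) (l + r) (W ⁻¹' {w}))
      = ∫⁻ t, ∫⁻ x, g x * jacPair (k := k) (l := l) (m := m) T W x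
          ∂(volumeOn (n := k) r (T ⁻¹' {t} ∩ W ⁻¹' {w})) ∂(riemVolume l 𝒯) := by
  have hs₁ : ∀ x, g x * jac (k := k) (m := m) W x ≠ 0 → x ∈ Φ.target :=
    fun x hx => hgΦ x (left_ne_zero_of_mul hx)
  have hs₂ : ∀ x, g x * jacPair (k := k) (l := l) (m := m) T W x ≠ 0 → x ∈ Φ.target :=
    fun x hx => hgΦ x (left_ne_zero_of_mul hx)
  by_cases hw : w ∈ σ.target
  · have hb := σ.map_target hw
    rw [← σ.right_inv hw, h.lintegral_fibre hb hg₁ hs₁]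
    have hm := h.measurable_lintegral_jointFibre hT.continuous hW.continuous hg₂ hs₂
      (σ (σ.symm w))
    rw [riemVolume, h.isLocalParam_left.lintegral_volumeOn τ.open_target.measurableSet ?_
      h.continuousOn_volDensity_left hm ?_]
    · have hz : ∀ a ∉ τ.source, ∫⁻ z, fibreIntegrand (k := k) Φ
          (fun x => g x * jac (k := k) (m := m) W x) (a, σ.symm w, z) = 0 := by
        intro a ha
        rw [← lintegral_zero (μ := (volume : Measure (EuclideanSpace ℝ (Fin r))))]
        refine lintegral_congr fun z => indicator_of_notMem (fun hp => ha ?_) _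
        exact h.fst_mem _ hp
      rw [← setLIntegral_eq_of_support_subset (s := τ.source) fun a ha => by
        by_contra ha'
        exact ha (hz a ha')]
      refine setLIntegral_congr_fun τ.open_source.measurableSet fun a ha => ?_
      beta_reduce
      rw [h.lintegral_jointFibre ha hb hg₂ hs₂, ← lintegral_const_mul]
      · refine lintegral_congr fun z => ?_
        by_cases hp : (a, σ.symm w, z) ∈ Φ.source
        · have key := h.jac_mul_fibreDensity hk hT hW hp
          rw [fibreIntegrand, jointFibreIntegrand, indicator_of_mem hp, indicator_of_mem hp]
          calc _ = g (Φ (a, σ.symm w, z)) * (jac (k := k) (m := m) W (Φ (a, σ.symm w, z)) *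
                ENNReal.ofReal (fibreDensity (k := k) Φ (a, σ.symm w, z))) := by ring
            _ = _ := by rw [key]; ring
        · rw [fibreIntegrand, jointFibreIntegrand, indicator_of_notMem hp, indicator_of_notMem hp,
            mul_zero]
      · exact (h.measurable_jointFibreIntegrand hg₂).comp (by fun_prop)
    · rintro t ⟨ht, -⟩
      exact ⟨τ.symm t, τ.map_target ht, τ.right_inv ht⟩
    · intro t ht
      by_contra ht'
      refine ht ?_
      rw [h.lintegral_jointFibre_eq_indicator hT.continuous hW.continuous hb hg₂ hs₂,
        indicator_of_notMem ht']
  · rw [lintegral_volumeOn_eq_zero (isClosed_singleton.preimage hW.continuous).measurableSet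
      fun x hx => h.eq_zero_of_notMem_target hw hs₁ hx]
    refine (lintegral_eq_zero_of_ae_eq_zero (Eventually.of_forall fun t => ?_)).symm
    exact lintegral_volumeOn_eq_zero ((isClosed_singleton.preimage hT.continuous).inter
      (isClosed_singleton.preimage hW.continuous)).measurableSet
      fun x hx => h.eq_zero_of_notMem_target hw hs₂ hx.2

end IsAdaptedChart

end LocalCoarea

/-! ### The coarea formula -/

section Coarea

open Set Filter Topology

set_option linter.unusedSectionVars false

/-- Cutting `g` along the disjointed cover replaces a partition of unity, since the pieces need only
be measurable. -/
theorem exists_measurable_seq_tsum_eq {X : Type*} [MeasurableSpace X] {O : ℕ → Set X}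
    (hO : ∀ n, MeasurableSet (O n)) {g : X → ℝ≥0∞} (hg : Measurable g)
    (hgO : ∀ x, g x ≠ 0 → ∃ n, x ∈ O n) :
    ∃ G : ℕ → X → ℝ≥0∞, (∀ n, Measurable (G n)) ∧ (∀ n x, G n x ≠ 0 → x ∈ O n) ∧
      ∀ x, ∑' n, G n x = g x := by
  refine ⟨fun n => (disjointed O n).indicator g,
    fun n => hg.indicator (MeasurableSet.disjointed hO n), fun n x hx => ?_, fun x => ?_⟩
  · exact disjointed_subset O n (mem_of_indicator_ne_zero hx)
  · by_cases hx : g x = 0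
    · have : ∀ n, (disjointed O n).indicator g x = 0 := fun n => by
        by_cases h : x ∈ disjointed O n
        · rw [indicator_of_mem h, hx]
        · exact indicator_of_notMem h _
      simp [this, hx]
    · obtain ⟨n, hn⟩ : ∃ n, x ∈ disjointed O n := by
        rw [← mem_iUnion, iUnion_disjointed, mem_iUnion]
        exact hgO x hx
      rw [tsum_eq_single n fun j hj => indicator_of_notMem (fun hxj => ?_) _, indicator_of_mem hn]
      exact (disjoint_disjointed O hj).le_bot ⟨hxj, hn⟩

variable {k l m r : ℕ}
  {𝒳 : Type*} [TopologicalSpace 𝒳] [SecondCountableTopology 𝒳]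
  [ChartedSpace (EuclideanSpace ℝ (Fin k)) 𝒳] [IsManifold (𝓡 k) ∞ 𝒳]
  [RiemannianBundle (fun x : 𝒳 => TangentSpace (𝓡 k) x)]
  [IsContMDiffRiemannianBundle (𝓡 k) ∞ (EuclideanSpace ℝ (Fin k))
      (fun x : 𝒳 => TangentSpace (𝓡 k) x)]
  [MeasurableSpace 𝒳] [BorelSpace 𝒳]
  {𝒲 : Type*} [TopologicalSpace 𝒲] [T2Space 𝒲]
  [ChartedSpace (EuclideanSpace ℝ (Fin m)) 𝒲] [IsManifold (𝓡 m) ∞ 𝒲]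
  [RiemannianBundle (fun w : 𝒲 => TangentSpace (𝓡 m) w)]
  [IsContMDiffRiemannianBundle (𝓡 m) ∞ (EuclideanSpace ℝ (Fin m))
      (fun w : 𝒲 => TangentSpace (𝓡 m) w)]
  {𝒯 : Type*} [TopologicalSpace 𝒯] [T2Space 𝒯]
  [ChartedSpace (EuclideanSpace ℝ (Fin l)) 𝒯] [IsManifold (𝓡 l) ∞ 𝒯]
  [RiemannianBundle (fun t : 𝒯 => TangentSpace (𝓡 l) t)]
  [IsContMDiffRiemannianBundle (𝓡 l) ∞ (EuclideanSpace ℝ (Fin l))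
      (fun t : 𝒯 => TangentSpace (𝓡 l) t)]
  [MeasurableSpace 𝒯] [BorelSpace 𝒯]
  {T : 𝒳 → 𝒯} {W : 𝒳 → 𝒲}

/-- `O` is empty or the image of an adapted chart. -/
def IsAdaptedDomain (r : ℕ) (T : 𝒳 → 𝒯) (W : 𝒳 → 𝒲) (O : Set 𝒳) : Prop :=
  O = ∅ ∨ ∃ (Φ : OpenPartialHomeomorph
      (EuclideanSpace ℝ (Fin l) × EuclideanSpace ℝ (Fin m) × EuclideanSpace ℝ (Fin r)) 𝒳)
    (τ : OpenPartialHomeomorph (EuclideanSpace ℝ (Fin l)) 𝒯)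
    (σ : OpenPartialHomeomorph (EuclideanSpace ℝ (Fin m)) 𝒲),
    IsAdaptedChart (k := k) T W Φ τ σ ∧ O = Φ.target

theorem surjective_pairDeriv_iff {x : 𝒳} :
    Function.Surjective (pairDeriv (k := k) (l := l) (m := m) T W x) ↔
      ∀ (a : TangentSpace (𝓡 l) (T x)) (b : TangentSpace (𝓡 m) (W x)),
        ∃ v, mfderiv (𝓡 k) (𝓡 l) T x v = a ∧ mfderiv (𝓡 k) (𝓡 m) W x v = b := by
  constructor
  · intro h a b
    obtain ⟨v, hv⟩ := h (WithLp.toLp 2 (a, b))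
    have hv' := congrArg WithLp.ofLp hv
    exact ⟨v, congrArg Prod.fst hv', congrArg Prod.snd hv'⟩
  · intro h y
    obtain ⟨v, hv1, hv2⟩ := h (WithLp.ofLp y).1 (WithLp.ofLp y).2
    exact ⟨v, congrArg (WithLp.toLp 2) (Prod.ext hv1 hv2)⟩

/-- The adapted charts at regular points form an open cover, from which second countability extracts
a countable one. -/
theorem exists_seq_isAdaptedDomain (hk : k = l + m + r)
    (hT : ContMDiff (𝓡 k) (𝓡 l) ∞ T) (hW : ContMDiff (𝓡 k) (𝓡 m) ∞ W) :
    ∃ O : ℕ → Set 𝒳, (∀ n, IsAdaptedDomain (k := k) (l := l) (m := m) r T W (O n)) ∧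
      ∀ x, Function.Surjective (pairDeriv (k := k) (l := l) (m := m) T W x) →
        ∃ n, x ∈ O n := by
  let Z := {x : 𝒳 // Function.Surjective (pairDeriv (k := k) (l := l) (m := m) T W x)}
  have hex : ∀ x : Z, ∃ O : Set 𝒳, IsOpen O ∧ x.1 ∈ O ∧
      IsAdaptedDomain (k := k) (l := l) (m := m) r T W O := by
    intro x
    obtain ⟨Φ, τ, σ, hx, h⟩ := exists_isAdaptedChart hk hT hW (surjective_pairDeriv_iff.1 x.2)
    exact ⟨Φ.target, Φ.open_target, hx, Or.inr ⟨Φ, τ, σ, h, rfl⟩⟩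
  choose O hOo hxO hO using hex
  obtain ⟨C, hC, hCO⟩ := TopologicalSpace.isOpen_iUnion_countable O hOo
  -- Adding the empty set makes the family nonempty, hence the range of a sequence, even if there
  -- are no regular points.
  obtain ⟨f, hf⟩ := ((hC.image O).insert ∅).exists_eq_range (insert_nonempty _ _)
  refine ⟨f, fun n => ?_, fun x hx => ?_⟩
  · have : f n ∈ insert ∅ (O '' C) := hf ▸ mem_range_self n
    rcases this with h | ⟨x, -, h⟩
    · exact Or.inl h
    · exact h ▸ hO x
  · have : x ∈ ⋃ i ∈ C, O i := hCO ▸ mem_iUnion.2 ⟨⟨x, hx⟩, hxO ⟨x, hx⟩⟩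
    simp only [mem_iUnion] at this
    obtain ⟨i, hi, hxi⟩ := this
    have hm : O i ∈ range f := hf ▸ Or.inr ⟨i, hi, rfl⟩
    obtain ⟨n, hn⟩ := hm
    exact ⟨n, hn ▸ hxi⟩

namespace IsAdaptedDomain

variable {O : Set 𝒳}

theorem isOpen (h : IsAdaptedDomain (k := k) (l := l) (m := m) r T W O) : IsOpen O := by
  rcases h with rfl | ⟨Φ, τ, σ, -, rfl⟩
  · exact isOpen_empty
  · exact Φ.open_target

theorem continuousOn_jac (h : IsAdaptedDomain (k := k) (l := l) (m := m) r T W O)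
    (hk : k = l + m + r) (hW : ContMDiff (𝓡 k) (𝓡 m) ∞ W) :
    ContinuousOn (jac (k := k) (m := m) W) O := by
  rcases h with rfl | ⟨Φ, τ, σ, h, rfl⟩
  · exact continuousOn_empty _
  · exact h.continuousOn_jac hk hW

theorem continuousOn_jacPair (h : IsAdaptedDomain (k := k) (l := l) (m := m) r T W O)
    (hk : k = l + m + r) (hT : ContMDiff (𝓡 k) (𝓡 l) ∞ T) (hW : ContMDiff (𝓡 k) (𝓡 m) ∞ W) :
    ContinuousOn (jacPair (k := k) (l := l) (m := m) T W) O := by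
  rcases h with rfl | ⟨Φ, τ, σ, h, rfl⟩
  · exact continuousOn_empty _
  · exact h.continuousOn_jacPair hk hT hW

theorem measurable_lintegral_jointFibre
    (h : IsAdaptedDomain (k := k) (l := l) (m := m) r T W O)
    (hT : Continuous T) (hW : Continuous W) {g : 𝒳 → ℝ≥0∞} (hg : Measurable g)
    (hgO : ∀ x, g x ≠ 0 → x ∈ O) (w : 𝒲) :
    Measurable fun t => ∫⁻ x, g x ∂(volumeOn (n := k) r (T ⁻¹' {t} ∩ W ⁻¹' {w})) := by
  rcases h with rfl | ⟨Φ, τ, σ, h, rfl⟩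
  · have : ∀ x, g x = 0 := fun x => by simpa using mt (hgO x)
    simp [this]
  · exact h.measurable_lintegral_jointFibre hT hW hg hgO w

theorem coarea (h : IsAdaptedDomain (k := k) (l := l) (m := m) r T W O) (hk : k = l + m + r)
    (hT : ContMDiff (𝓡 k) (𝓡 l) ∞ T) (hW : ContMDiff (𝓡 k) (𝓡 m) ∞ W)
    {g : 𝒳 → ℝ≥0∞} (hgO : ∀ x, g x ≠ 0 → x ∈ O)
    (hg₁ : Measurable fun x => g x * jac (k := k) (m := m) W x)
    (hg₂ : Measurable fun x => g x * jacPair (k := k) (l := l) (m := m) T W x) (w : 𝒲) :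
    ∫⁻ x, g x * jac (k := k) (m := m) W x ∂(volumeOn (n := k) (l + r) (W ⁻¹' {w}))
      = ∫⁻ t, ∫⁻ x, g x * jacPair (k := k) (l := l) (m := m) T W x
          ∂(volumeOn (n := k) r (T ⁻¹' {t} ∩ W ⁻¹' {w})) ∂(riemVolume l 𝒯) := by
  rcases h with rfl | ⟨Φ, τ, σ, h, rfl⟩
  · have : ∀ x, g x = 0 := fun x => by simpa using mt (hgO x)
    simp [this]
  · exact h.coarea hk hT hW hgO hg₁ hg₂ w

end IsAdaptedDomain

/-- Lets a Jacobian factor, controlled only on an adapted domain, be multiplied by a function that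
vanishes elsewhere. -/
theorem ContinuousOn.measurable_mul {X : Type*} [TopologicalSpace X] [MeasurableSpace X]
    [BorelSpace X] {O : Set X} (hO : IsOpen O) {c : X → ℝ≥0∞} (hc : ContinuousOn c O)
    {g : X → ℝ≥0∞} (hg : Measurable g) (hgO : ∀ x, g x ≠ 0 → x ∈ O) :
    Measurable fun x => g x * c x := by
  have h := measurable_indicator_mul_comp hO hc continuousOn_id hg
  convert h using 1
  ext x
  by_cases hx : x ∈ O
  · rw [indicator_of_mem hx, mul_comm, id]
  · rw [indicator_of_notMem hx, not_not.1 (mt (hgO x) hx), zero_mul]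

theorem measurable_mul_jacPair (hk : k = l + m + r)
    (hT : ContMDiff (𝓡 k) (𝓡 l) ∞ T) (hW : ContMDiff (𝓡 k) (𝓡 m) ∞ W)
    {g : 𝒳 → ℝ≥0∞} (hg : Measurable g)
    (hreg : ∀ x, g x ≠ 0 →
      Function.Surjective (pairDeriv (k := k) (l := l) (m := m) T W x)) :
    Measurable fun x => g x * jacPair (k := k) (l := l) (m := m) T W x := by
  obtain ⟨O, hO, hcov⟩ := exists_seq_isAdaptedDomain (r := r) hk hT hW
  obtain ⟨G, hGm, hGO, hGg⟩ := exists_measurable_seq_tsum_eq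
    (fun n => (hO n).isOpen.measurableSet) hg fun x hx => hcov x (hreg x hx)
  simp only [← hGg, ← ENNReal.tsum_mul_right]
  exact Measurable.tsum fun n =>
    ((hO n).continuousOn_jacPair hk hT hW).measurable_mul (hO n).isOpen (hGm n) (hGO n)

theorem measurable_lintegral_jointFibre (hk : k = l + m + r)
    (hT : ContMDiff (𝓡 k) (𝓡 l) ∞ T) (hW : ContMDiff (𝓡 k) (𝓡 m) ∞ W)
    {g : 𝒳 → ℝ≥0∞} (hg : Measurable g)
    (hreg : ∀ x, g x ≠ 0 →
      Function.Surjective (pairDeriv (k := k) (l := l) (m := m) T W x)) (w : 𝒲) :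
    Measurable fun t => ∫⁻ x, g x ∂(volumeOn (n := k) r (T ⁻¹' {t} ∩ W ⁻¹' {w})) := by
  obtain ⟨O, hO, hcov⟩ := exists_seq_isAdaptedDomain (r := r) hk hT hW
  obtain ⟨G, hGm, hGO, hGg⟩ := exists_measurable_seq_tsum_eq
    (fun n => (hO n).isOpen.measurableSet) hg fun x hx => hcov x (hreg x hx)
  have : ∀ t, ∫⁻ x, g x ∂(volumeOn (n := k) r (T ⁻¹' {t} ∩ W ⁻¹' {w}))
      = ∑' n, ∫⁻ x, G n x ∂(volumeOn (n := k) r (T ⁻¹' {t} ∩ W ⁻¹' {w})) := by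
    intro t
    rw [← lintegral_tsum fun n => (hGm n).aemeasurable]
    simp only [hGg]
  simp only [this]
  exact Measurable.tsum fun n =>
    (hO n).measurable_lintegral_jointFibre hT.continuous hW.continuous (hGm n) (hGO n) w

/-- The coarea formula for the restriction of `T` to the fibres of `W`. -/
theorem lintegral_fibre_mul_jac (hk : k = l + m + r)
    (hT : ContMDiff (𝓡 k) (𝓡 l) ∞ T) (hW : ContMDiff (𝓡 k) (𝓡 m) ∞ W)
    {g : 𝒳 → ℝ≥0∞} (hg : Measurable g)
    (hreg : ∀ x, g x ≠ 0 →
      Function.Surjective (pairDeriv (k := k) (l := l) (m := m) T W x)) (w : 𝒲) :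
    ∫⁻ x, g x * jac (k := k) (m := m) W x ∂(volumeOn (n := k) (l + r) (W ⁻¹' {w}))
      = ∫⁻ t, ∫⁻ x, g x * jacPair (k := k) (l := l) (m := m) T W x
          ∂(volumeOn (n := k) r (T ⁻¹' {t} ∩ W ⁻¹' {w})) ∂(riemVolume l 𝒯) := by
  obtain ⟨O, hO, hcov⟩ := exists_seq_isAdaptedDomain (r := r) hk hT hW
  obtain ⟨G, hGm, hGO, hGg⟩ := exists_measurable_seq_tsum_eq
    (fun n => (hO n).isOpen.measurableSet) hg fun x hx => hcov x (hreg x hx)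
  have h₁ : ∀ n, Measurable fun x => G n x * jac (k := k) (m := m) W x := fun n =>
    ((hO n).continuousOn_jac hk hW).measurable_mul (hO n).isOpen (hGm n) (hGO n)
  have h₂ : ∀ n, Measurable fun x => G n x * jacPair (k := k) (l := l) (m := m) T W x := fun n =>
    ((hO n).continuousOn_jacPair hk hT hW).measurable_mul (hO n).isOpen (hGm n) (hGO n)
  simp only [← hGg, ← ENNReal.tsum_mul_right]
  rw [lintegral_tsum fun n => (h₁ n).aemeasurable]
  have : ∀ t, ∫⁻ x, ∑' n, G n x * jacPair (k := k) (l := l) (m := m) T W x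
        ∂(volumeOn (n := k) r (T ⁻¹' {t} ∩ W ⁻¹' {w}))
      = ∑' n, ∫⁻ x, G n x * jacPair (k := k) (l := l) (m := m) T W x
        ∂(volumeOn (n := k) r (T ⁻¹' {t} ∩ W ⁻¹' {w})) :=
    fun t => lintegral_tsum fun n => (h₂ n).aemeasurable
  simp only [this]
  rw [lintegral_tsum fun n => ((hO n).measurable_lintegral_jointFibre hT.continuous hW.continuous
    (h₂ n) (fun x hx => hGO n x (left_ne_zero_of_mul hx)) w).aemeasurable]
  exact tsum_congr fun n => (hO n).coarea hk hT hW (hGO n) (h₁ n) (h₂ n) w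

end Coarea

/-! ### The coarea formula for a single submersion, with a constant map to `ℝ⁰` as the second map.
-/

section Submersion

open Set Filter Topology

set_option linter.unusedSectionVars false

/-- An isometry of the target conjugates `A A'`, which leaves its determinant unchanged. -/
theorem jacFactor_linearIsometryEquiv_comp {E F G : Type*} [NormedAddCommGroup E]
    [InnerProductSpace ℝ E] [FiniteDimensional ℝ E] [NormedAddCommGroup F] [InnerProductSpace ℝ F]
    [FiniteDimensional ℝ F] [NormedAddCommGroup G] [InnerProductSpace ℝ G]
    [FiniteDimensional ℝ G] (e : F ≃ₗᵢ[ℝ] G) (A : E →ₗ[ℝ] F) :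
    jacFactor (e.toLinearEquiv.toLinearMap ∘ₗ A) = jacFactor A := by
  have h : LinearMap.adjoint e.toLinearEquiv.toLinearMap = e.symm.toLinearEquiv.toLinearMap := by
    refine ((LinearMap.eq_adjoint_iff _ _).2 fun x y => ?_).symm
    have := e.inner_map_map (e.symm x) y
    rw [e.apply_symm_apply] at this
    exact this.symm
  have h2 : (e.toLinearEquiv.toLinearMap ∘ₗ A) ∘ₗ
      LinearMap.adjoint (e.toLinearEquiv.toLinearMap ∘ₗ A)
      = e.toLinearEquiv.toLinearMap ∘ₗ (A ∘ₗ LinearMap.adjoint A) ∘ₗ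
        e.toLinearEquiv.symm.toLinearMap := by
    rw [LinearMap.adjoint_comp, h]
    rfl
  rw [jacFactor, jacFactor, h2, LinearMap.det_conj]

theorem jacFactor_eq_one_of_finrank_eq_zero {E F : Type*} [NormedAddCommGroup E]
    [InnerProductSpace ℝ E] [FiniteDimensional ℝ E] [NormedAddCommGroup F] [InnerProductSpace ℝ F]
    [FiniteDimensional ℝ F] (hF : Module.finrank ℝ F = 0) (A : E →ₗ[ℝ] F) : jacFactor A = 1 := by
  rw [jacFactor, LinearMap.det_eq_one_of_finrank_eq_zero hF]
  simp

/-- The isometric inclusion of the first factor if the second factor is trivial. -/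
noncomputable def WithLp.prodSubsingletonIsometry (F Z : Type*) [NormedAddCommGroup F]
    [InnerProductSpace ℝ F] [NormedAddCommGroup Z] [InnerProductSpace ℝ Z] [Subsingleton Z] :
    F ≃ₗᵢ[ℝ] WithLp 2 (F × Z) where
  toFun y := WithLp.toLp 2 (y, 0)
  map_add' y y' := congrArg (WithLp.toLp 2) (Prod.ext rfl (Subsingleton.elim _ _))
  map_smul' c y := congrArg (WithLp.toLp 2) (Prod.ext rfl (Subsingleton.elim _ _))
  invFun q := (WithLp.ofLp q).1
  left_inv y := rfl
  right_inv q := congrArg (WithLp.toLp 2) (Prod.ext rfl (Subsingleton.elim _ _))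
  norm_map' y := by
    change ‖WithLp.toLp 2 (y, (0 : Z))‖ = ‖y‖
    simp

variable {k m r : ℕ}
  {𝒳 : Type*} [TopologicalSpace 𝒳] [SecondCountableTopology 𝒳]
  [ChartedSpace (EuclideanSpace ℝ (Fin k)) 𝒳] [IsManifold (𝓡 k) ∞ 𝒳]
  [RiemannianBundle (fun x : 𝒳 => TangentSpace (𝓡 k) x)]
  [IsContMDiffRiemannianBundle (𝓡 k) ∞ (EuclideanSpace ℝ (Fin k))
      (fun x : 𝒳 => TangentSpace (𝓡 k) x)]
  [MeasurableSpace 𝒳] [BorelSpace 𝒳]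
  {𝒲 : Type*} [TopologicalSpace 𝒲] [T2Space 𝒲]
  [ChartedSpace (EuclideanSpace ℝ (Fin m)) 𝒲] [IsManifold (𝓡 m) ∞ 𝒲]
  [RiemannianBundle (fun w : 𝒲 => TangentSpace (𝓡 m) w)]
  [IsContMDiffRiemannianBundle (𝓡 m) ∞ (EuclideanSpace ℝ (Fin m))
      (fun w : 𝒲 => TangentSpace (𝓡 m) w)]
  [MeasurableSpace 𝒲] [BorelSpace 𝒲]
  {W : 𝒳 → 𝒲}

/-- `W` takes the role of `T` and the constant map that of `W`; the tangent space of the point is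
trivial, so adding it as an orthogonal summand is an isometry. -/
theorem jacPair_const (x : 𝒳) :
    jacPair (k := k) (l := m) (m := 0) W (fun _ : 𝒳 => (0 : EuclideanSpace ℝ (Fin 0))) x
      = jac (k := k) (m := m) W x := by
  have : Subsingleton (TangentSpace (𝓡 0) (0 : EuclideanSpace ℝ (Fin 0))) :=
    inferInstanceAs (Subsingleton (EuclideanSpace ℝ (Fin 0)))
  rw [jac, ← jacFactor_linearIsometryEquiv_comp (WithLp.prodSubsingletonIsometry
    (TangentSpace (𝓡 m) (W x)) (TangentSpace (𝓡 0) (0 : EuclideanSpace ℝ (Fin 0)))), jacPair]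
  congr 1
  ext1 v
  exact congrArg (WithLp.toLp 2) (Prod.ext rfl (Subsingleton.elim _ _))

theorem jac_const (x : 𝒳) :
    jac (k := k) (m := 0) (fun _ : 𝒳 => (0 : EuclideanSpace ℝ (Fin 0))) x = 1 :=
  jacFactor_eq_one_of_finrank_eq_zero
    (F := TangentSpace (𝓡 0) (0 : EuclideanSpace ℝ (Fin 0)))
    (finrank_euclideanSpace_fin (𝕜 := ℝ) (n := 0)) _

theorem surjective_pairDeriv_const {x : 𝒳}
    (h : Function.Surjective (mfderiv (𝓡 k) (𝓡 m) W x)) :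
    Function.Surjective (pairDeriv (k := k) (l := m) (m := 0) W
      (fun _ : 𝒳 => (0 : EuclideanSpace ℝ (Fin 0))) x) := by
  have : Subsingleton (TangentSpace (𝓡 0) (0 : EuclideanSpace ℝ (Fin 0))) :=
    inferInstanceAs (Subsingleton (EuclideanSpace ℝ (Fin 0)))
  refine surjective_pairDeriv_iff.2 fun a b => ?_
  obtain ⟨v, hv⟩ := h a
  exact ⟨v, hv, Subsingleton.elim _ _⟩

theorem inter_preimage_const (w : 𝒲) : W ⁻¹' {w} ∩
    (fun _ : 𝒳 => (0 : EuclideanSpace ℝ (Fin 0))) ⁻¹' {0} = W ⁻¹' {w} := by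
  ext x
  simp

theorem measurable_mul_jac_of_submersion (hk : k = m + r) (hW : ContMDiff (𝓡 k) (𝓡 m) ∞ W)
    {g : 𝒳 → ℝ≥0∞} (hg : Measurable g)
    (hreg : ∀ x, g x ≠ 0 → Function.Surjective (mfderiv (𝓡 k) (𝓡 m) W x)) :
    Measurable fun x => g x * jac (k := k) (m := m) W x := by
  have h := measurable_mul_jacPair (l := m) (m := 0) (r := r) hk hW
    (contMDiff_const (c := (0 : EuclideanSpace ℝ (Fin 0)))) hg
    fun x hx => surjective_pairDeriv_const (hreg x hx)
  simpa only [jacPair_const] using h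

theorem measurable_lintegral_volumeOn_fibre (hk : k = m + r) (hW : ContMDiff (𝓡 k) (𝓡 m) ∞ W)
    {g : 𝒳 → ℝ≥0∞} (hg : Measurable g)
    (hreg : ∀ x, g x ≠ 0 → Function.Surjective (mfderiv (𝓡 k) (𝓡 m) W x)) :
    Measurable fun w => ∫⁻ x, g x ∂(volumeOn (n := k) r (W ⁻¹' {w})) := by
  have h := measurable_lintegral_jointFibre (l := m) (m := 0) (r := r) hk hW
    (contMDiff_const (c := (0 : EuclideanSpace ℝ (Fin 0)))) hg
    (fun x hx => surjective_pairDeriv_const (hreg x hx)) 0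
  simpa only [inter_preimage_const] using h

/-- The coarea formula. -/
theorem lintegral_riemVolume_eq_lintegral_fibre (hk : k = m + r)
    (hW : ContMDiff (𝓡 k) (𝓡 m) ∞ W) {g : 𝒳 → ℝ≥0∞} (hg : Measurable g)
    (hreg : ∀ x, g x ≠ 0 → Function.Surjective (mfderiv (𝓡 k) (𝓡 m) W x)) :
    ∫⁻ x, g x ∂(riemVolume k 𝒳) = ∫⁻ w, ∫⁻ x, g x * jac (k := k) (m := m) W x
      ∂(volumeOn (n := k) r (W ⁻¹' {w})) ∂(riemVolume m 𝒲) := by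
  -- The fibre of the constant map is all of `𝒳` and its Jacobian factor is one, so the left side
  -- becomes the integral over `𝒳`.
  have h := lintegral_fibre_mul_jac (l := m) (m := 0) (r := r) hk hW
    (contMDiff_const (c := (0 : EuclideanSpace ℝ (Fin 0)))) hg
    (fun x hx => surjective_pairDeriv_const (hreg x hx)) 0
  simp only [inter_preimage_const, jacPair_const, jac_const, mul_one] at h
  subst hk
  rw [← h, riemVolume]
  congr 2
  ext x
  simp

end Submersion

/-! ### Conditional laws, conditional densities and P-values -/

section Conditional

open Set Filter Topology

set_option linter.unusedSectionVars false

variable {k l m : ℕ}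
  {𝒳 : Type*} [TopologicalSpace 𝒳] [SecondCountableTopology 𝒳]
  [ChartedSpace (EuclideanSpace ℝ (Fin k)) 𝒳] [IsManifold (𝓡 k) ∞ 𝒳]
  [RiemannianBundle (fun x : 𝒳 => TangentSpace (𝓡 k) x)]
  [IsContMDiffRiemannianBundle (𝓡 k) ∞ (EuclideanSpace ℝ (Fin k))
      (fun x : 𝒳 => TangentSpace (𝓡 k) x)]
  [MeasurableSpace 𝒳] [BorelSpace 𝒳]
  {𝒲 : Type*} [TopologicalSpace 𝒲] [T2Space 𝒲]
  [ChartedSpace (EuclideanSpace ℝ (Fin m)) 𝒲] [IsManifold (𝓡 m) ∞ 𝒲]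
  [RiemannianBundle (fun w : 𝒲 => TangentSpace (𝓡 m) w)]
  [IsContMDiffRiemannianBundle (𝓡 m) ∞ (EuclideanSpace ℝ (Fin m))
      (fun w : 𝒲 => TangentSpace (𝓡 m) w)]
  [MeasurableSpace 𝒲] [BorelSpace 𝒲]
  {𝒯 : Type*} [TopologicalSpace 𝒯] [T2Space 𝒯]
  [ChartedSpace (EuclideanSpace ℝ (Fin l)) 𝒯] [IsManifold (𝓡 l) ∞ 𝒯]
  [RiemannianBundle (fun t : 𝒯 => TangentSpace (𝓡 l) t)]
  [IsContMDiffRiemannianBundle (𝓡 l) ∞ (EuclideanSpace ℝ (Fin l))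
      (fun t : 𝒯 => TangentSpace (𝓡 l) t)]
  [MeasurableSpace 𝒯] [BorelSpace 𝒯]
  {W : 𝒳 → 𝒲} {T : 𝒳 → 𝒯} {f : 𝒳 → ℝ≥0}

theorem marginalDensity_eq_setLIntegral (w : 𝒲) :
    marginalDensity (k := k) (m := m) f W w
      = ∫⁻ x in univ, f x * jac (k := k) (m := m) W x ∂(fibreVolume (k := k) (m := m) W w) := by
  rw [Measure.restrict_univ, marginalDensity]

theorem condLaw_apply (hfJ : Measurable fun x => (f x : ℝ≥0∞) * jac (k := k) (m := m) W x)
    (w : 𝒲) {A : Set 𝒳} (hA : MeasurableSet A) :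
    condLaw (k := k) (m := m) f W w A
      = (∫⁻ x in A, f x * jac (k := k) (m := m) W x ∂(fibreVolume (k := k) (m := m) W w))
        / marginalDensity (k := k) (m := m) f W w := by
  rw [condLaw, withDensity_apply _ hA]
  simp only [div_eq_mul_inv]
  exact lintegral_mul_const _ hfJ

/-! ### The law of `W` and the disintegration of `P` along `W`. -/

section Submersion

variable (hf : Measurable f) (hmk : m ≤ k) (hW : ContMDiff (𝓡 k) (𝓡 m) ∞ W)
  (hreg : ∀ x, f x ≠ 0 → Function.Surjective (mfderiv (𝓡 k) (𝓡 m) W x))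

include hf hmk hW hreg

theorem measurable_density_mul_jac :
    Measurable fun x => (f x : ℝ≥0∞) * jac (k := k) (m := m) W x :=
  measurable_mul_jac_of_submersion (r := k - m) (by omega) hW hf.coe_nnreal_ennreal
    fun x hx => hreg x (by simpa using hx)

theorem measurable_setLIntegral_fibreVolume {A : Set 𝒳} (hA : MeasurableSet A) :
    Measurable fun w => ∫⁻ x in A, f x * jac (k := k) (m := m) W x
      ∂(fibreVolume (k := k) (m := m) W w) := by
  simp only [← lintegral_indicator hA]
  refine measurable_lintegral_volumeOn_fibre (r := k - m) (by omega) hW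
    ((measurable_density_mul_jac hf hmk hW hreg).indicator hA) fun x hx => hreg x ?_
  have := left_ne_zero_of_mul (indicator_apply_ne_zero.1 hx).2
  simpa using this

theorem measurable_condLaw {A : Set 𝒳} (hA : MeasurableSet A) :
    Measurable fun w => condLaw (k := k) (m := m) f W w A := by
  simp only [condLaw_apply (measurable_density_mul_jac hf hmk hW hreg) _ hA,
    marginalDensity_eq_setLIntegral]
  exact (measurable_setLIntegral_fibreVolume hf hmk hW hreg hA).div
    (measurable_setLIntegral_fibreVolume hf hmk hW hreg MeasurableSet.univ)

theorem measurable_marginalDensity : Measurable (marginalDensity (k := k) (m := m) f W) := by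
  have := measurable_setLIntegral_fibreVolume hf hmk hW hreg MeasurableSet.univ
  simpa only [← marginalDensity_eq_setLIntegral] using this

/-- The coarea formula for `f` times the indicator of `A ∩ W⁻¹B`: on the fibre over `w` the
indicator of `W⁻¹B` is constant, equal to that of `B` at `w`. -/
theorem withDensity_riemVolume_inter_preimage {A : Set 𝒳} (hA : MeasurableSet A) {B : Set 𝒲}
    (hB : MeasurableSet B) :
    (riemVolume k 𝒳).withDensity (fun x => (f x : ℝ≥0∞)) (A ∩ W ⁻¹' B)
      = ∫⁻ w in B, ∫⁻ x in A, f x * jac (k := k) (m := m) W x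
        ∂(fibreVolume (k := k) (m := m) W w) ∂(riemVolume m 𝒲) := by
  have hWB : MeasurableSet (W ⁻¹' B) := hW.continuous.measurable hB
  have hAB := hA.inter hWB
  rw [withDensity_apply _ hAB, ← lintegral_indicator hAB,
    lintegral_riemVolume_eq_lintegral_fibre (r := k - m) (by omega) hW
      (hf.coe_nnreal_ennreal.indicator hAB) fun x hx => hreg x ?_, ← lintegral_indicator hB]
  · refine lintegral_congr fun w => ?_
    by_cases hw : w ∈ B
    · rw [indicator_of_mem hw, ← lintegral_indicator hA]
      refine lintegral_volumeOn_congr (isClosed_singleton.preimage hW.continuous).measurableSet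
        fun x hx => ?_
      have hx' : W x ∈ B := (show W x = w from hx) ▸ hw
      by_cases hxA : x ∈ A
      · rw [indicator_of_mem (show x ∈ A ∩ W ⁻¹' B from ⟨hxA, hx'⟩), indicator_of_mem hxA]
      · rw [indicator_of_notMem (fun h => hxA h.1), indicator_of_notMem hxA, zero_mul]
    · rw [indicator_of_notMem hw]
      refine lintegral_volumeOn_eq_zero (isClosed_singleton.preimage hW.continuous).measurableSet
        fun x hx => ?_
      have hx' : W x ∉ B := (show W x = w from hx) ▸ hw
      rw [indicator_of_notMem (fun h => hx' h.2), zero_mul]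
  · simpa using (indicator_apply_ne_zero.1 hx).2

theorem map_withDensity_riemVolume :
    ((riemVolume k 𝒳).withDensity fun x => (f x : ℝ≥0∞)).map W
      = (riemVolume m 𝒲).withDensity (marginalDensity (k := k) (m := m) f W) := by
  ext B hB
  rw [Measure.map_apply hW.continuous.measurable hB, withDensity_apply _ hB]
  have := withDensity_riemVolume_inter_preimage hf hmk hW hreg MeasurableSet.univ hB
  simpa only [univ_inter, ← marginalDensity_eq_setLIntegral] using this

theorem withDensity_inter_preimage_eq_lintegral_condLaw
    [IsFiniteMeasure ((riemVolume k 𝒳).withDensity fun x => (f x : ℝ≥0∞))]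
    {A : Set 𝒳} (hA : MeasurableSet A) {B : Set 𝒲} (hB : MeasurableSet B) :
    (riemVolume k 𝒳).withDensity (fun x => (f x : ℝ≥0∞)) (A ∩ W ⁻¹' B)
      = ∫⁻ w in B, condLaw (k := k) (m := m) f W w A
        ∂(((riemVolume k 𝒳).withDensity fun x => (f x : ℝ≥0∞)).map W) := by
  have hmm := measurable_marginalDensity hf hmk hW hreg
  -- The total integral of `f_W` is the mass of the finite measure, so `f_W` is finite almost
  -- everywhere.
  have hfin : ∫⁻ w, marginalDensity (k := k) (m := m) f W w ∂(riemVolume m 𝒲) ≠ ⊤ := by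
    have h := congrArg (fun μ : Measure 𝒲 => μ univ) (map_withDensity_riemVolume hf hmk hW hreg)
    beta_reduce at h
    rw [Measure.map_apply hW.continuous.measurable MeasurableSet.univ,
      withDensity_apply _ MeasurableSet.univ, Measure.restrict_univ] at h
    rw [← h]
    exact measure_ne_top _ _
  rw [withDensity_riemVolume_inter_preimage hf hmk hW hreg hA hB,
    map_withDensity_riemVolume hf hmk hW hreg,
    setLIntegral_withDensity_eq_setLIntegral_mul _ hmm (measurable_condLaw hf hmk hW hreg hA) hB]
  refine lintegral_congr_ae (ae_restrict_of_ae ?_)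
  filter_upwards [ae_lt_top hmm hfin] with w hw
  rw [Pi.mul_apply, condLaw_apply (measurable_density_mul_jac hf hmk hW hreg) _ hA]
  -- Where `f_W(w) = 0` the integral over `A` vanishes too, being at most `f_W(w)`, so multiplying
  -- by `f_W(w)` and dividing by it is harmless there as well.
  refine (ENNReal.mul_div_cancel' (fun h0 => ?_) fun ht => absurd ht hw.ne).symm
  refine le_antisymm ?_ bot_le
  rw [← h0, marginalDensity]
  exact lintegral_mono' Measure.restrict_le_self le_rfl

theorem isProbabilityMeasure_condLaw {w : 𝒲} (h0 : 0 < marginalDensity (k := k) (m := m) f W w)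
    (ht : marginalDensity (k := k) (m := m) f W w < ⊤) :
    IsProbabilityMeasure (condLaw (k := k) (m := m) f W w) := by
  constructor
  rw [condLaw_apply (measurable_density_mul_jac hf hmk hW hreg) _ MeasurableSet.univ,
    ← marginalDensity_eq_setLIntegral]
  exact ENNReal.div_self h0.ne' ht.ne

end Submersion

/-! ### The conditional law of `T` and the P-value. -/

section Pair

theorem jacPair_ne_zero (hk : l + m ≤ k) (hT : ContMDiff (𝓡 k) (𝓡 l) ∞ T)
    (hW : ContMDiff (𝓡 k) (𝓡 m) ∞ W) {x : 𝒳}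
    (hx : Function.Surjective (pairDeriv (k := k) (l := l) (m := m) T W x)) :
    jacPair (k := k) (l := l) (m := m) T W x ≠ 0 := by
  have hk' : k = l + m + (k - (l + m)) := by omega
  obtain ⟨Φ, τ, σ, hxΦ, h⟩ := exists_isAdaptedChart hk' hT hW (surjective_pairDeriv_iff.1 hx)
  have hp := Φ.map_target hxΦ
  rw [← Φ.right_inv hxΦ, h.jacPair_apply hk' hT hW hp]
  have := h.density_pos hp
  have := h.jointFibreDensity_pos hp
  have := h.volDensity_left_pos (h.fst_mem _ hp)
  have := h.volDensity_right_pos (h.snd_mem _ hp)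
  refine (ENNReal.ofReal_pos.2 ?_).ne'
  positivity

variable (hf : Measurable f) (hk : l + m ≤ k) (hT : ContMDiff (𝓡 k) (𝓡 l) ∞ T)
  (hW : ContMDiff (𝓡 k) (𝓡 m) ∞ W)
  (hreg : ∀ x, f x ≠ 0 → Function.Surjective (pairDeriv (k := k) (l := l) (m := m) T W x))

include hf hk hT hW hreg

theorem measurable_condDensity (w : 𝒲) :
    Measurable fun t => condDensity (k := k) (l := l) (m := m) f T W t w := by
  have hk' : k = l + m + (k - (l + m)) := by omega
  have hreg' : ∀ x, (f x : ℝ≥0∞) / marginalDensity (k := k) (m := m) f W w ≠ 0 →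
      Function.Surjective (pairDeriv (k := k) (l := l) (m := m) T W x) := by
    intro x hx
    rw [div_eq_mul_inv] at hx
    exact hreg x (by simpa using left_ne_zero_of_mul hx)
  exact measurable_lintegral_jointFibre hk' hT hW
    (measurable_mul_jacPair hk' hT hW (hf.coe_nnreal_ennreal.div_const _) hreg')
    (fun x hx => hreg' x (left_ne_zero_of_mul hx)) w

theorem measurable_fStar (w : 𝒲) :
    Measurable fun t => fStar (k := k) (l := l) (m := m) f T W t w :=
  measurable_lintegral_jointFibre (r := k - (l + m)) (by omega) hT hW hf.coe_nnreal_ennreal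
    (fun x hx => hreg x (by simpa using hx)) w

/-- The fibrewise coarea formula for `f / f_W(w)` times the indicator of `T⁻¹B`, which is constant
on each fibre of `T`. It holds for every `w`, including those with `f_W(w)` zero or infinite. -/
theorem map_condLaw (w : 𝒲) :
    (condLaw (k := k) (m := m) f W w).map T = (riemVolume l 𝒯).withDensity
      fun t => condDensity (k := k) (l := l) (m := m) f T W t w := by
  have hk' : k = l + m + (k - (l + m)) := by omega
  ext B hB
  have hTB : MeasurableSet (T ⁻¹' B) := hT.continuous.measurable hB
  set c := marginalDensity (k := k) (m := m) f W w with hc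
  rw [Measure.map_apply hT.continuous.measurable hB, withDensity_apply _ hB, condLaw,
    withDensity_apply _ hTB, ← lintegral_indicator hTB, ← lintegral_indicator hB]
  have key := lintegral_fibre_mul_jac (g := (T ⁻¹' B).indicator fun x => (f x : ℝ≥0∞) / c)
    hk' hT hW ((hf.coe_nnreal_ennreal.div_const c).indicator hTB) (fun x hx => hreg x ?_) w
  -- Reconciles the two expressions for the dimension of the fibre of `W`; it relies on `l + m ≤ k`,
  -- the subtractions being truncated.
  · have hkm : l + (k - (l + m)) = k - m := by omega
    rw [hkm] at key
    refine Eq.trans ?_ (key.trans ?_)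
    · refine lintegral_congr fun x => ?_
      by_cases hx : x ∈ T ⁻¹' B
      · rw [indicator_of_mem hx, indicator_of_mem hx]
        simp only [div_eq_mul_inv]
        ring
      · rw [indicator_of_notMem hx, indicator_of_notMem hx, zero_mul]
    · refine lintegral_congr fun t => ?_
      have hS : MeasurableSet (T ⁻¹' {t} ∩ W ⁻¹' {w}) :=
        ((isClosed_singleton.preimage hT.continuous).inter
          (isClosed_singleton.preimage hW.continuous)).measurableSet
      by_cases ht : t ∈ B
      · rw [indicator_of_mem ht, condDensity, jointFibreVolume]
        refine lintegral_volumeOn_congr hS fun x hx => ?_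
        have hTx : T x = t := hx.1
        have hxB : x ∈ T ⁻¹' B := by rwa [mem_preimage, hTx]
        rw [indicator_of_mem hxB]
      · rw [indicator_of_notMem ht]
        refine lintegral_volumeOn_eq_zero hS fun x hx => ?_
        have hTx : T x = t := hx.1
        have hxB : x ∉ T ⁻¹' B := by rwa [mem_preimage, hTx]
        rw [indicator_of_notMem hxB, zero_mul]
  · have hx' : (f x : ℝ≥0∞) / c ≠ 0 := (indicator_apply_ne_zero.1 hx).2
    rw [div_eq_mul_inv] at hx'
    simpa using left_ne_zero_of_mul hx'

theorem correctedCondDensity_eq_fStar_div (t : 𝒯) (w : 𝒲) :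
    correctedCondDensity (k := k) (l := l) (m := m) f T W t w
      = fStar (k := k) (l := l) (m := m) f T W t w
        / marginalDensity (k := k) (m := m) f W w := by
  set c := marginalDensity (k := k) (m := m) f W w with hc
  have h : ∀ x, (f x : ℝ≥0∞) / c * jacPair (k := k) (l := l) (m := m) T W x
      / jacPair (k := k) (l := l) (m := m) T W x = f x * c⁻¹ := by
    intro x
    -- Where `f = 0` both sides vanish whatever the Jacobian factor is; elsewhere regularity makes
    -- it nonzero, and it is finite by definition, so it cancels.
    by_cases hx : f x = 0
    · simp [hx]
    · rw [ENNReal.mul_div_cancel_right (jacPair_ne_zero hk hT hW (hreg x hx))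
        ENNReal.ofReal_ne_top, div_eq_mul_inv]
  rw [correctedCondDensity, fStar, div_eq_mul_inv,
    ← lintegral_mul_const _ hf.coe_nnreal_ennreal]
  exact lintegral_congr h

/-- The two statistics differ by the factor `1 / f_W(w₀)`, which is positive and finite, so they
define the same event. -/
theorem condPValue_correctedCondDensity {x₀ : 𝒳}
    (h0 : 0 < marginalDensity (k := k) (m := m) f W (W x₀))
    (ht : marginalDensity (k := k) (m := m) f W (W x₀) < ⊤) :
    condPValue (k := k) (m := m) f T W
        (fun t => correctedCondDensity (k := k) (l := l) (m := m) f T W t (W x₀)) x₀ =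
      condPValue (k := k) (m := m) f T W
        (fun t => fStar (k := k) (l := l) (m := m) f T W t (W x₀)) x₀ := by
  rw [condPValue, condPValue]
  congr 1
  ext t
  simp only [mem_ofPred_eq, correctedCondDensity_eq_fStar_div hf hk hT hW hreg, div_eq_mul_inv]
  exact ENNReal.mul_le_mul_iff_left (ENNReal.inv_ne_zero.2 ht.ne) (ENNReal.inv_ne_top.2 h0.ne')

end Pair

end Conditional

theorem lemma3 {k l m : ℕ}
    -- the Riemannian manifolds `𝒳`, `𝒲`, `𝒯`, of dimensions `k`, `m`, `l`
    {𝒳 : Type*} [TopologicalSpace 𝒳] [T2Space 𝒳] [SecondCountableTopology 𝒳]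
    [ChartedSpace (EuclideanSpace ℝ (Fin k)) 𝒳] [IsManifold (𝓡 k) ∞ 𝒳]
    [RiemannianBundle (fun x : 𝒳 => TangentSpace (𝓡 k) x)]
    [IsContMDiffRiemannianBundle (𝓡 k) ∞ (EuclideanSpace ℝ (Fin k))
      (fun x : 𝒳 => TangentSpace (𝓡 k) x)]
    [MeasurableSpace 𝒳] [BorelSpace 𝒳]
    {𝒲 : Type*} [TopologicalSpace 𝒲] [T2Space 𝒲] [SecondCountableTopology 𝒲]
    [ChartedSpace (EuclideanSpace ℝ (Fin m)) 𝒲] [IsManifold (𝓡 m) ∞ 𝒲]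
    [RiemannianBundle (fun w : 𝒲 => TangentSpace (𝓡 m) w)]
    [IsContMDiffRiemannianBundle (𝓡 m) ∞ (EuclideanSpace ℝ (Fin m))
      (fun w : 𝒲 => TangentSpace (𝓡 m) w)]
    [MeasurableSpace 𝒲] [BorelSpace 𝒲]
    {𝒯 : Type*} [TopologicalSpace 𝒯] [T2Space 𝒯] [SecondCountableTopology 𝒯]
    [ChartedSpace (EuclideanSpace ℝ (Fin l)) 𝒯] [IsManifold (𝓡 l) ∞ 𝒯]
    [RiemannianBundle (fun t : 𝒯 => TangentSpace (𝓡 l) t)]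
    [IsContMDiffRiemannianBundle (𝓡 l) ∞ (EuclideanSpace ℝ (Fin l))
      (fun t : 𝒯 => TangentSpace (𝓡 l) t)]
    [MeasurableSpace 𝒯] [BorelSpace 𝒯]
    -- the probability measure `P` with density `f` with respect to volume on `𝒳`
    (P : Measure 𝒳) [IsProbabilityMeasure P] (f : 𝒳 → ℝ≥0) (hf : Measurable f)
    (hP : P = (riemVolume k 𝒳).withDensity fun x => (f x : ℝ≥0∞))
    -- the onto, smooth maps
    (W : 𝒳 → 𝒲) (hW : ContMDiff (𝓡 k) (𝓡 m) ∞ W) (hW_onto : Function.Surjective W)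
    (T : 𝒳 → 𝒯) (hT : ContMDiff (𝓡 k) (𝓡 l) ∞ T) (hT_onto : Function.Surjective T)
    -- `(T, W)` is regular where `f` is positive, so that `J_{(T,W)}` is finite there
    (hreg : ∀ x, f x ≠ 0 →
      Function.Surjective (pairDeriv (k := k) (l := l) (m := m) T W x)) :
    -- `f_W` is the density of `W`
    (Measurable (marginalDensity (k := k) (m := m) f W) ∧
      P.map W = (riemVolume m 𝒲).withDensity (marginalDensity (k := k) (m := m) f W)) ∧
    -- `w ↦ P(· | W(x) = w)` is a version of the conditional distribution of `x` given `W`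
    (∀ A : Set 𝒳, MeasurableSet A →
      Measurable (fun w => condLaw (k := k) (m := m) f W w A) ∧
      ∀ B : Set 𝒲, MeasurableSet B →
        P (A ∩ W ⁻¹' B) = ∫⁻ w in B, condLaw (k := k) (m := m) f W w A ∂(P.map W)) ∧
    -- the conditional density of `T` given `W = w`
    (∀ w, 0 < marginalDensity (k := k) (m := m) f W w →
      marginalDensity (k := k) (m := m) f W w < ⊤ →
      IsProbabilityMeasure (condLaw (k := k) (m := m) f W w) ∧
      Measurable (fun t => condDensity (k := k) (l := l) (m := m) f T W t w) ∧
      (condLaw (k := k) (m := m) f W w).map T = (riemVolume l 𝒯).withDensity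
        (fun t => condDensity (k := k) (l := l) (m := m) f T W t w)) ∧
    -- the P-value from the volume-corrected conditional density is the one from `f*_{T,W}(· | w₀)`
    (∀ x₀, 0 < marginalDensity (k := k) (m := m) f W (W x₀) →
      marginalDensity (k := k) (m := m) f W (W x₀) < ⊤ →
      Measurable (fun t => fStar (k := k) (l := l) (m := m) f T W t (W x₀)) ∧
      condPValue (k := k) (m := m) f T W
          (fun t => correctedCondDensity (k := k) (l := l) (m := m) f T W t (W x₀)) x₀ =
        condPValue (k := k) (m := m) f T W
          (fun t => fStar (k := k) (l := l) (m := m) f T W t (W x₀)) x₀) := by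
  have hne : ∃ x, f x ≠ 0 := by
    by_contra! h
    have h0 : P = 0 := by simp [hP, h]
    exact IsProbabilityMeasure.ne_zero P h0
  obtain ⟨z, hz⟩ := hne
  -- Since `P` has mass one, `f` is nonzero at some point, where surjectivity of the differential
  -- forces `l + m ≤ k`. Hence `k - m` and `k - (l + m)` are the true fibre dimensions.
  have hlk : l + m ≤ k := by
    have h := LinearMap.finrank_le_finrank_of_surjective (hreg z hz)
    have h1 : Module.finrank ℝ (TangentSpace (𝓡 k) z) = k := finrank_euclideanSpace_fin
    have h2 : Module.finrank ℝ (WithLp 2 (TangentSpace (𝓡 l) (T z) × TangentSpace (𝓡 m) (W z)))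
        = l + m := by
      have h3 : Module.finrank ℝ (TangentSpace (𝓡 l) (T z)) = l := finrank_euclideanSpace_fin
      have h4 : Module.finrank ℝ (TangentSpace (𝓡 m) (W z)) = m := finrank_euclideanSpace_fin
      rw [(WithLp.linearEquiv 2 ℝ _).finrank_eq, Module.finrank_prod, h3, h4]
    omega
  have hmk : m ≤ k := by omega
  have hregW : ∀ x, f x ≠ 0 → Function.Surjective (mfderiv (𝓡 k) (𝓡 m) W x) := by
    intro x hx b
    obtain ⟨v, -, hv⟩ := surjective_pairDeriv_iff.1 (hreg x hx) 0 b
    exact ⟨v, hv⟩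
  subst hP
  exact ⟨⟨measurable_marginalDensity hf hmk hW hregW,
      map_withDensity_riemVolume hf hmk hW hregW⟩,
    fun A hA => ⟨measurable_condLaw hf hmk hW hregW hA, fun B hB =>
      withDensity_inter_preimage_eq_lintegral_condLaw hf hmk hW hregW hA hB⟩,
    fun w h0 ht => ⟨isProbabilityMeasure_condLaw hf hmk hW hregW h0 ht,
      measurable_condDensity hf hlk hT hW hreg w, map_condLaw hf hlk hT hW hreg w⟩,
    fun x₀ h0 ht => ⟨measurable_fStar hf hlk hT hW hreg (W x₀),
      condPValue_correctedCondDensity hf hlk hT hW hreg h0 ht⟩⟩
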